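/- Let $\alpha>0$ and let $\mathcal F^2_\alpha$ be the Fock space of entire functions $f$ with $\|f\|^2=\frac{\alpha}{\pi}\int_{\mathbb C}|f(z)|^2e^{-\alpha|z|^2}\,dm(z)<\infty$ ($m$ being area measure), with inner product $\langle f,g\rangle=\frac{\alpha}{\pi}\int_{\mathbb C}f(z)\overline{g(z)}e^{-\alpha|z|^2}\,dm(z)$. Put $e_k(z)=\sqrt{\alpha^k/k!}\,z^k$ for $k\ge 0$ and $T_\lambda f(\zeta)=e^{\alpha\bar\lambda\zeta-\frac{\alpha}{2}|\lambda|^2}f(\zeta-\lambda)$ for $\lambda\in\mathbb C$. Let $X=\{(\lambda,m_\lambda)\}_{\lambda\in\Lambda}$ be a divisor, that is, a family of distinct points $\lambda\in\mathbb C$ with multiplicities $m_\lambda\in\mathbb N$. It is called interpolating for $\mathcal F^2_\alpha$ if for every family $\{v_\lambda^{(k)}\}_{\lambda\in\Lambda,\,0\le k<m_\lambda}$ of complex numbers with $\sum_{\lambda\in\Lambda}\sum_{k=0}^{m_\lambda-1}|v_\lambda^{(k)}|^2<\infty$ there is $f\in\mathcal F^2_\alpha$ with $\langle f,T_\lambda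 e_k\rangle=v_\lambda^{(k)}$ for all $\lambda\in\Lambda$ and $0\le k<m_\lambda$. Denote by $D(z,r)$ the open disc of radius $r$ centered at $z$. (a) If $X$ is an interpolating divisor for $\mathcal F^2_\alpha$, then there exists $C>0$ such that the discs $D(\lambda,\sqrt{m_\lambda/\alpha}-C)$, $\lambda\in\Lambda$, $m_\lambda>\alpha C^2$, are pairwise disjoint. (b) Conversely, if the discs $D(\lambda,\sqrt{m_\lambda/\alpha}+C)$, $\lambda\in\Lambda$, are pairwise disjoint for some $C>0$, then $X$ is an interpolating divisor for $\mathcal F^2_\alpha$. -/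

import Mathlib

open MeasureTheory

noncomputable section

namespace Fock

/-- `f` belongs to the Fock space of parameter `α`: it is entire and
`|f(z)|² exp(-α|z|²)` has finite integral with respect to the area measure. -/
def Mem (α : ℝ) (f : ℂ → ℂ) : Prop :=
  Differentiable ℂ f ∧
    Integrable (fun z : ℂ => ‖f z‖ ^ 2 * Real.exp (-α * ‖z‖ ^ 2)) volume

/-- The inner product of the Fock space,
`⟨f, g⟩ = (α / π) ∫ f(z) conj(g(z)) exp(-α|z|²) dm(z)`, conjugate linear in `g`. -/
def ip (α : ℝ) (f g : ℂ → ℂ) : ℂ :=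
  ((α / Real.pi : ℝ) : ℂ) *
    ∫ z : ℂ, f z * (starRingEnd ℂ) (g z) * ((Real.exp (-α * ‖z‖ ^ 2) : ℝ) : ℂ)

/-- The normalized monomials `e_k(z) = √(α^k) / √(k!) z^k`. -/
def e (α : ℝ) (k : ℕ) (z : ℂ) : ℂ :=
  ((Real.sqrt (α ^ k) / Real.sqrt (Nat.factorial k : ℝ) : ℝ) : ℂ) * z ^ k

/-- The translation `(T_w f)(ζ) = exp(α conj(w) ζ - (α/2)|w|²) f(ζ - w)`. -/
def T (α : ℝ) (w : ℂ) (f : ℂ → ℂ) (ζ : ℂ) : ℂ :=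
  Complex.exp ((α : ℂ) * (starRingEnd ℂ) w * ζ - ((α / 2 * ‖w‖ ^ 2 : ℝ) : ℂ)) * f (ζ - w)

/-- The divisor `{(l, m l)}`, `l ∈ Λ`, is interpolating for the Fock space: every square
summable family of data `v l k`, `l ∈ Λ`, `0 ≤ k < m l`, is attained by some `f` in the space. -/
def IsInterpolating (α : ℝ) (Λ : Set ℂ) (m : Λ → ℕ) : Prop :=
  ∀ v : (l : Λ) → Fin (m l) → ℂ,
    Summable (fun l : Λ => ∑ k : Fin (m l), ‖v l k‖ ^ 2) →
      ∃ f : ℂ → ℂ, Mem α f ∧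
        ∀ (l : Λ) (k : Fin (m l)), ip α f (T α (l : ℂ) (e α (k : ℕ))) = v l k

end Fock

end

/-! Necessity. Since every square summable datum is attained, uniform boundedness gives a lower
Riesz bound, with constant M, for the functions `T_λ e_k` (`exists_lower_riesz_bound`). The squared
coefficients of the normalized kernel `T_z e_0` along the orthonormal family `(T_λ e_k)_k` are the
Poisson probabilities of mean α|z-λ|². If z lies in D(λ, √(m_λ/α) - C), a Chernoff bound
(`one_sub_sum_poisson_le`) puts `T_z e_0` within exp(-αC²/2) of the span of the first m_λ of them. A
point common to two shrunken discs would yield two nearly equal vectors, with coefficients of nearly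
unit ℓ² norm over different points λ. For C large in terms of M this violates the Riesz bound.

Sufficiency. For finitely many points, the local solutions φ_l = Σ_k v_l^(k) T_l e_k are glued by
cutoffs into f0, and f0 is corrected to the entire function f = f0 - F w, where F = ∏ (z-l)^(m_l)
and ∂̄w = ∂̄f0 / F. The equation is solved in L² with weight 1/G (`exists_weak_dbar_solution`). Here
log G is α|z|² with its Laplacian swept out of a disc of squared radius about m_l/α around each l.
The removed mass is exactly that of m_l log|z-l|², so |F|² G equals exp(α|z|²) away from these discs
and is at most exp(α|z|²) inside them, while log G stays subharmonic because the discs are disjoint.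
Near l the function f - φ_l equals -F w with w locally square integrable, which forces a zero of
order m_l, and such a function is orthogonal to `T_l e_k` for k < m_l. The gap C bounds the cutoff
gradients uniformly (`exists_glue`, `exists_interpolant_finset`).

The bound does not depend on the finite set, so Hilbert space duality
(`exists_inner_eq_of_forall_finset`) yields a solution in L² of all conditions at once. Weak
holomorphy is included among these conditions, and Weyl's lemma (`exists_entire_ae_eq`) returns the
solution to the Fock space. -/

/-! ### Wirtinger derivatives -/

/-- The Wirtinger derivative `∂f/∂z`. -/
noncomputable def dz (f : ℂ → ℂ) (z : ℂ) : ℂ :=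
  (fderiv ℝ f z 1 - Complex.I * fderiv ℝ f z Complex.I) / 2

/-- The Wirtinger derivative `∂f/∂z̄`. -/
noncomputable def dbar (f : ℂ → ℂ) (z : ℂ) : ℂ :=
  (fderiv ℝ f z 1 + Complex.I * fderiv ℝ f z Complex.I) / 2

/-- `f` is real differentiable at `z` with Wirtinger derivatives `∂f = a` and `∂̄f = b`. -/
def HasWirtinger (f : ℂ → ℂ) (a b : ℂ) (z : ℂ) : Prop :=
  HasFDerivAt f (a • (ContinuousLinearMap.id ℝ ℂ) + b • (Complex.conjCLE : ℂ →L[ℝ] ℂ)) z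

namespace HasWirtinger

open ComplexConjugate

variable {f g : ℂ → ℂ} {a b c d z : ℂ}

theorem dz_eq (h : HasWirtinger f a b z) : dz f z = a := by
  rw [dz, HasFDerivAt.fderiv h]
  simp
  linear_combination (-a / 2 + b / 2) * Complex.I_mul_I

theorem dbar_eq (h : HasWirtinger f a b z) : dbar f z = b := by
  rw [dbar, HasFDerivAt.fderiv h]
  simp
  linear_combination (a / 2 - b / 2) * Complex.I_mul_I

theorem congr (h : HasWirtinger f a b z) (ha : a = c) (hb : b = d) : HasWirtinger f c d z := by
  subst ha hb; exact h

theorem differentiableAt (h : HasWirtinger f a b z) : DifferentiableAt ℝ f z :=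
  HasFDerivAt.differentiableAt h

theorem of_differentiableAt (h : DifferentiableAt ℝ f z) :
    HasWirtinger f (dz f z) (dbar f z) z := by
  have := h.hasFDerivAt
  rw [HasWirtinger]
  convert! this using 1
  ext w
  have hw : w = (w.re : ℝ) • (1 : ℂ) + (w.im : ℝ) • Complex.I := by
    simp [Complex.re_add_im]
  have h2 : fderiv ℝ f z w = w.re * fderiv ℝ f z 1 + w.im * fderiv ℝ f z Complex.I := by
    conv_lhs => rw [hw]
    rw [map_add, map_smul, map_smul]
    simp
  have h3 : conj w = w.re - w.im * Complex.I := by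
    conv_lhs => rw [← Complex.re_add_im w]
    simp [-Complex.re_add_im, sub_eq_add_neg]
  have h4 : w = w.re + w.im * Complex.I := (Complex.re_add_im w).symm
  rw [h2]
  simp only [dz, dbar, add_apply, FunLike.coe_smul,
    Pi.smul_apply, ContinuousLinearMap.id_apply, smul_eq_mul, ContinuousLinearEquiv.coe_coe,
    Complex.conjCLE_apply, h3]
  nth_rewrite 1 [h4]
  linear_combination (- w.im * fderiv ℝ f z Complex.I) * Complex.I_mul_I

theorem const (c : ℂ) : HasWirtinger (fun _ => c) 0 0 z := by
  unfold HasWirtinger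
  convert! hasFDerivAt_const (𝕜 := ℝ) c z using 1
  ext w; simp

theorem id : HasWirtinger (fun w => w) 1 0 z := by
  unfold HasWirtinger
  convert! hasFDerivAt_id (𝕜 := ℝ) z using 1
  ext w; simp

theorem add (hf : HasWirtinger f a b z) (hg : HasWirtinger g c d z) :
    HasWirtinger (fun w => f w + g w) (a + c) (b + d) z := by
  unfold HasWirtinger at *
  convert! HasFDerivAt.fun_add hf hg using 1
  ext w; simp; ring

theorem sub (hf : HasWirtinger f a b z) (hg : HasWirtinger g c d z) :
    HasWirtinger (fun w => f w - g w) (a - c) (b - d) z := by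
  unfold HasWirtinger at *
  convert! HasFDerivAt.fun_sub hf hg using 1
  ext w; simp; ring

theorem mul (hf : HasWirtinger f a b z) (hg : HasWirtinger g c d z) :
    HasWirtinger (fun w => f w * g w) (a * g z + f z * c) (b * g z + f z * d) z := by
  unfold HasWirtinger at *
  convert! HasFDerivAt.mul hf hg using 1
  ext w; simp; ring

theorem sum {ι : Type*} {s : Finset ι} {F : ι → ℂ → ℂ} {A B : ι → ℂ}
    (h : ∀ i ∈ s, HasWirtinger (F i) (A i) (B i) z) :
    HasWirtinger (fun w => ∑ i ∈ s, F i w) (∑ i ∈ s, A i) (∑ i ∈ s, B i) z := by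
  unfold HasWirtinger at *
  convert! HasFDerivAt.fun_sum h using 1
  ext w; simp [Finset.sum_add_distrib, Finset.sum_mul]

theorem conj_comp (hf : HasWirtinger f a b z) :
    HasWirtinger (fun w => conj (f w)) (conj b) (conj a) z := by
  unfold HasWirtinger at *
  have := (Complex.conjCLE : ℂ →L[ℝ] ℂ).hasFDerivAt.comp z hf
  convert! this using 1
  ext w; simp [add_comm]

theorem of_hasDerivAt (h : HasDerivAt f a z) : HasWirtinger f a 0 z := by
  unfold HasWirtinger
  convert! h.hasFDerivAt.restrictScalars ℝ using 1
  ext w; simp [mul_comm]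

theorem ofReal_comp {u : ℂ → ℝ} {k : ℝ → ℝ} {k' : ℝ}
    (hu : HasWirtinger (fun w => (u w : ℂ)) a b z) (hk : HasDerivAt k k' (u z)) :
    HasWirtinger (fun w => ((k (u w) : ℝ) : ℂ)) (k' * a) (k' * b) z := by
  unfold HasWirtinger at *
  have h1 : HasFDerivAt u (Complex.reCLM ∘L
      (a • (ContinuousLinearMap.id ℝ ℂ) + b • (Complex.conjCLE : ℂ →L[ℝ] ℂ))) z := by
    have := Complex.reCLM.hasFDerivAt.comp z hu
    simpa [Function.comp_def] using this
  have h0 : HasFDerivAt (fun w => (u w : ℂ)) (Complex.ofRealCLM ∘L (Complex.reCLM ∘L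
      (a • (ContinuousLinearMap.id ℝ ℂ) + b • (Complex.conjCLE : ℂ →L[ℝ] ℂ)))) z := by
    simpa [Function.comp_def] using Complex.ofRealCLM.hasFDerivAt.comp z h1
  have h2 := hk.comp_hasFDerivAt z h1
  have h3 := Complex.ofRealCLM.hasFDerivAt.comp z h2
  have h4 := h0.unique hu
  convert! h3 using 1
  ext w
  have h5 := DFunLike.congr_fun h4 w
  simp at h5 ⊢
  linear_combination -(k' : ℂ) * h5

theorem normSq_sub (l : ℂ) :
    HasWirtinger (fun w => ((‖w - l‖ ^ 2 : ℝ) : ℂ)) (conj (z - l)) (z - l) z := by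
  have h : HasWirtinger (fun w : ℂ => w - l) 1 0 z := by
    simpa using id.sub (const (z := z) l)
  have h2 := h.mul h.conj_comp
  simp only [map_one, map_zero, one_mul, mul_zero, zero_mul, add_zero, mul_one, zero_add] at h2
  convert! h2 using 2 with w
  rw [Complex.mul_conj, Complex.normSq_eq_norm_sq]

end HasWirtinger

theorem dbar_continuous {f : ℂ → ℂ} (hf : ContDiff ℝ 1 f) : Continuous (dbar f) := by
  have := hf.continuous_fderiv one_ne_zero
  unfold dbar
  fun_prop

theorem dz_continuous {f : ℂ → ℂ} (hf : ContDiff ℝ 1 f) : Continuous (dz f) := by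
  have := hf.continuous_fderiv one_ne_zero
  unfold dz
  fun_prop

theorem contDiff_fderiv_apply_complex {f : ℂ → ℂ} (hf : ContDiff ℝ 2 f) (v : ℂ) :
    ContDiff ℝ 1 (fun z => fderiv ℝ f z v) :=
  (hf.fderiv_right (m := 1) (by norm_num)).clm_apply contDiff_const

theorem contDiff_dbar {f : ℂ → ℂ} (hf : ContDiff ℝ 2 f) : ContDiff ℝ 1 (dbar f) := by
  have h1 := contDiff_fderiv_apply_complex hf 1
  have h2 := contDiff_fderiv_apply_complex hf Complex.I
  unfold dbar
  fun_prop

theorem contDiff_dz {f : ℂ → ℂ} (hf : ContDiff ℝ 2 f) : ContDiff ℝ 1 (dz f) := by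
  have h1 := contDiff_fderiv_apply_complex hf 1
  have h2 := contDiff_fderiv_apply_complex hf Complex.I
  unfold dz
  fun_prop

theorem HasCompactSupport.dbar {f : ℂ → ℂ} (hf : HasCompactSupport f) :
    HasCompactSupport (dbar f) := by
  refine (hf.fderiv ℝ).mono ?_
  intro z hz
  contrapose! hz
  simp only [Function.mem_support, not_not] at hz ⊢
  simp [_root_.dbar, hz]

theorem HasCompactSupport.dz {f : ℂ → ℂ} (hf : HasCompactSupport f) :
    HasCompactSupport (dz f) := by
  refine (hf.fderiv ℝ).mono ?_
  intro z hz
  contrapose! hz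
  simp only [Function.mem_support, not_not] at hz ⊢
  simp [_root_.dz, hz]

theorem dbar_dz_comm {f : ℂ → ℂ} (hf : ContDiff ℝ 2 f) (z : ℂ) :
    dbar (dz f) z = dz (dbar f) z := by
  have hd : DifferentiableAt ℝ (fderiv ℝ f) z :=
    ((hf.fderiv_right (m := 1) (by norm_num)).differentiable one_ne_zero) z
  have key : ∀ v w : ℂ, fderiv ℝ (fun z => fderiv ℝ f z v) z w = fderiv ℝ (fderiv ℝ f) z w v := by
    intro v w
    rw [fderiv_clm_apply hd (by fun_prop)]
    simp
  have sym : fderiv ℝ (fderiv ℝ f) z 1 Complex.I = fderiv ℝ (fderiv ℝ f) z Complex.I 1 :=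
    (hf.contDiffAt (x := z)).isSymmSndFDerivAt (by simp) 1 Complex.I
  have d1 : ∀ v, DifferentiableAt ℝ (fun z => fderiv ℝ f z v) z := fun v =>
    (contDiff_fderiv_apply_complex hf v).differentiable one_ne_zero z
  have e1 : ∀ v, fderiv ℝ (dz f) z v =
      (fderiv ℝ (fderiv ℝ f) z v 1 - Complex.I * fderiv ℝ (fderiv ℝ f) z v Complex.I) / 2 := by
    intro v
    have : HasFDerivAt (dz f) ((2 : ℂ)⁻¹ • (fderiv ℝ (fun z => fderiv ℝ f z 1) z -
        Complex.I • fderiv ℝ (fun z => fderiv ℝ f z Complex.I) z)) z := by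
      have := (((d1 1).hasFDerivAt.sub ((d1 Complex.I).hasFDerivAt.const_mul Complex.I)).const_mul
        ((2 : ℂ)⁻¹))
      convert! this using 1
      ext w
      simp [dz]; ring
    rw [this.fderiv]
    simp [key]; ring
  have e2 : ∀ v, fderiv ℝ (dbar f) z v =
      (fderiv ℝ (fderiv ℝ f) z v 1 + Complex.I * fderiv ℝ (fderiv ℝ f) z v Complex.I) / 2 := by
    intro v
    have : HasFDerivAt (dbar f) ((2 : ℂ)⁻¹ • (fderiv ℝ (fun z => fderiv ℝ f z 1) z +
        Complex.I • fderiv ℝ (fun z => fderiv ℝ f z Complex.I) z)) z := by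
      have := (((d1 1).hasFDerivAt.add ((d1 Complex.I).hasFDerivAt.const_mul Complex.I)).const_mul
        ((2 : ℂ)⁻¹))
      convert! this using 1
      ext w
      simp [dbar]; ring
    rw [this.fderiv]
    simp [key]; ring
  rw [dbar, dz, e1, e1, e2, e2, sym]
  ring

theorem integral_fderiv_apply_eq_zero {f : ℂ → ℂ} (hf : ContDiff ℝ 1 f) (hc : HasCompactSupport f)
    (v : ℂ) : ∫ z, fderiv ℝ f z v = 0 := by
  -- Integration by parts against the constant 1.
  have h := integral_mul_fderiv_eq_neg_fderiv_mul_of_integrable (μ := (volume : Measure ℂ))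
    (f := fun _ : ℂ => (1 : ℂ)) (g := f) (v := v) (by simp)
    (by
      simp only [one_mul]
      exact ((hf.continuous_fderiv one_ne_zero).clm_apply continuous_const).integrable_of_hasCompactSupport
        (hc.fderiv_apply ℝ v))
    (by simpa using hf.continuous.integrable_of_hasCompactSupport hc)
    (by intros; fun_prop) (fun x _ => hf.differentiable one_ne_zero x)
  simpa using h

theorem integrable_fderiv_apply {f : ℂ → ℂ} (hf : ContDiff ℝ 1 f) (hc : HasCompactSupport f)
    (v : ℂ) : Integrable (fun z => fderiv ℝ f z v) :=
  ((hf.continuous_fderiv one_ne_zero).clm_apply continuous_const).integrable_of_hasCompactSupport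
        (hc.fderiv_apply ℝ v)

theorem integral_dbar_eq_zero {f : ℂ → ℂ} (hf : ContDiff ℝ 1 f) (hc : HasCompactSupport f) :
    ∫ z, dbar f z = 0 := by
  unfold dbar
  rw [integral_div, integral_add (integrable_fderiv_apply hf hc _)
    ((integrable_fderiv_apply hf hc _).const_mul _), integral_const_mul,
    integral_fderiv_apply_eq_zero hf hc, integral_fderiv_apply_eq_zero hf hc]
  simp

theorem integral_dz_eq_zero {f : ℂ → ℂ} (hf : ContDiff ℝ 1 f) (hc : HasCompactSupport f) :
    ∫ z, dz f z = 0 := by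
  unfold dz
  rw [integral_div, integral_sub (integrable_fderiv_apply hf hc _)
    ((integrable_fderiv_apply hf hc _).const_mul _), integral_const_mul,
    integral_fderiv_apply_eq_zero hf hc, integral_fderiv_apply_eq_zero hf hc]
  simp

/-! ### A weighted `L²` inequality for `∂̄` -/

section Weight

open ComplexConjugate

variable {G Q : ℂ → ℝ} {p : ℂ → ℂ}

theorem contDiff_one_of_hasWirtinger {f a b : ℂ → ℂ} (h : ∀ z, HasWirtinger f (a z) (b z) z)
    (ha : Continuous a) (hb : Continuous b) : ContDiff ℝ 1 f := by
  rw [contDiff_one_iff_fderiv]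
  refine ⟨fun z => (h z).differentiableAt, ?_⟩
  have : fderiv ℝ f = fun z =>
      a z • (ContinuousLinearMap.id ℝ ℂ) + b z • (Complex.conjCLE : ℂ →L[ℝ] ℂ) := by
    ext1 z
    exact HasFDerivAt.fderiv (h z)
  rw [this]
  fun_prop

/-- If `G = exp φ` with `∂φ = p` and `∂∂̄φ = Q`, then `∫ Q|χ|²G ≤ ∫ |∂̄χ|²G` for test
functions `χ`. -/
theorem integral_laplacian_mul_le (hG0 : ∀ z, 0 ≤ G z)
    (hG : ∀ z, HasWirtinger (fun w => (G w : ℂ)) (p z * G z) (conj (p z) * G z) z)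
    (hp : ContDiff ℝ 1 p) (hQ : ∀ z, dbar p z = Q z)
    {χ : ℂ → ℂ} (hχ : ContDiff ℝ 2 χ) (hc : HasCompactSupport χ) :
    ∫ z, Q z * ‖χ z‖ ^ 2 * G z ≤ ∫ z, ‖dbar χ z‖ ^ 2 * G z := by
  have hGc : Continuous (fun w => (G w : ℂ)) :=
    continuous_iff_continuousAt.2 fun z => (hG z).differentiableAt.continuousAt
  have hGr : Continuous G := Complex.continuous_re.comp hGc
  have hG1 : ContDiff ℝ 1 (fun w => (G w : ℂ)) := contDiff_one_of_hasWirtinger hG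
    (hp.continuous.mul hGc) ((Complex.continuous_conj.comp hp.continuous).mul hGc)
  have hQc : Continuous Q := by
    have h1 : Continuous fun z => ((Q z : ℝ) : ℂ) := by
      simp_rw [← hQ]
      exact dbar_continuous hp
    exact Complex.continuous_re.comp h1
  have hχ1 : ContDiff ℝ 1 χ := hχ.of_le (by norm_num)
  have hdb := contDiff_dbar hχ
  have hdz := contDiff_dz hχ
  have hconj : ContDiff ℝ 1 (fun z => conj (χ z)) := Complex.conjCLE.contDiff.comp hχ1
  set X : ℂ → ℂ := fun z => (G z : ℂ) * conj (χ z) * dbar χ z with hX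
  -- With G = exp φ, the term ∂χ + pχ is G⁻¹ ∂(Gχ). The commutator of this twisted derivative with
  -- ∂̄ is multiplication by -Q, so ∂X - ∂̄Y contains Q|χ|² and squares only. Its integral vanishes,
  -- and the square of the twisted derivative is dropped.
  set Y : ℂ → ℂ := fun z => (G z : ℂ) * conj (χ z) * (dz χ z + p z * χ z) with hY
  have hX1 : ContDiff ℝ 1 X := (hG1.mul hconj).mul hdb
  have hY1 : ContDiff ℝ 1 Y := (hG1.mul hconj).mul (hdz.add (hp.mul hχ1))
  have hcc : HasCompactSupport (fun z => conj (χ z)) := hc.comp_left (g := conj) (by simp)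
  have hXc : HasCompactSupport X := (hcc.mul_left).mul_right
  have hYc : HasCompactSupport Y := (hcc.mul_left).mul_right
  have key : ∀ z, dz X z - dbar Y z =
      ((G z * (‖dbar χ z‖ ^ 2 - ‖dz χ z + p z * χ z‖ ^ 2 - Q z * ‖χ z‖ ^ 2) : ℝ) : ℂ) := by
    intro z
    have w0 := HasWirtinger.of_differentiableAt (hχ1.differentiable one_ne_zero z)
    have w1 := HasWirtinger.of_differentiableAt (hdb.differentiable one_ne_zero z)
    have w2 := HasWirtinger.of_differentiableAt (hdz.differentiable one_ne_zero z)
    have w3 := HasWirtinger.of_differentiableAt (hp.differentiable one_ne_zero z)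
    have eX := (((hG z).mul w0.conj_comp).mul w1).dz_eq
    have eY := (((hG z).mul w0.conj_comp).mul (w2.add (w3.mul w0))).dbar_eq
    rw [hX, hY, eX, eY, dbar_dz_comm hχ, hQ]
    push_cast
    rw [← Complex.mul_conj', ← Complex.mul_conj', ← Complex.mul_conj']
    simp only [map_add, map_mul]
    ring
  have hint : ∫ z, (dz X z - dbar Y z) = 0 := by
    rw [integral_sub ((dz_continuous hX1).integrable_of_hasCompactSupport hXc.dz)
      ((dbar_continuous hY1).integrable_of_hasCompactSupport hYc.dbar),
      integral_dz_eq_zero hX1 hXc, integral_dbar_eq_zero hY1 hYc, sub_zero]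
  simp_rw [key] at hint
  rw [integral_complex_ofReal, Complex.ofReal_eq_zero] at hint
  have c1 : Continuous (dbar χ) := hdb.continuous
  have c2 : Continuous (dz χ) := hdz.continuous
  have c3 : Continuous χ := hχ.continuous
  have c4 : Continuous p := hp.continuous
  have i1 : Integrable (fun z => ‖dbar χ z‖ ^ 2 * G z) :=
    Continuous.integrable_of_hasCompactSupport (by fun_prop)
      ((hc.dbar.comp_left (g := fun x => ‖x‖ ^ 2) (by simp)).mul_right)
  have i2 : Integrable (fun z => Q z * ‖χ z‖ ^ 2 * G z) :=
    Continuous.integrable_of_hasCompactSupport (by fun_prop)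
      (((hc.comp_left (g := fun x => ‖x‖ ^ 2) (by simp)).mul_left).mul_right)
  have i3 : Integrable (fun z => ‖dz χ z + p z * χ z‖ ^ 2 * G z) :=
    Continuous.integrable_of_hasCompactSupport (by fun_prop)
      (((hc.dz.add hc.mul_left).comp_left (g := fun x => ‖x‖ ^ 2) (by simp)).mul_right)
  have e1 : ∀ z, G z * (‖dbar χ z‖ ^ 2 - ‖dz χ z + p z * χ z‖ ^ 2 - Q z * ‖χ z‖ ^ 2) =
      ‖dbar χ z‖ ^ 2 * G z - ‖dz χ z + p z * χ z‖ ^ 2 * G z - Q z * ‖χ z‖ ^ 2 * G z := by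
    intro z; ring
  simp_rw [e1] at hint
  have i13 : Integrable (fun z => ‖dbar χ z‖ ^ 2 * G z - ‖dz χ z + p z * χ z‖ ^ 2 * G z) :=
    i1.sub i3
  rw [integral_sub i13 i2, integral_sub i1 i3] at hint
  have : 0 ≤ ∫ z, ‖dz χ z + p z * χ z‖ ^ 2 * G z :=
    integral_nonneg fun z => mul_nonneg (by positivity) (hG0 z)
  linarith

end Weight

/-! ### Hilbert space duality -/

section Riesz

variable {H : Type*} [NormedAddCommGroup H] [InnerProductSpace ℂ H] [CompleteSpace H]

/-- The bound makes ℓ factor through the range of A as a bounded functional. Hahn–Banach extends it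
without increasing the norm, and Riesz represents the extension. -/
theorem exists_inner_eq_of_norm_le {V : Type*} [AddCommGroup V] [Module ℂ V]
    (A : V →ₗ[ℂ] H) (ℓ : V →ₗ[ℂ] ℂ) {K : ℝ} (hK : 0 ≤ K) (h : ∀ v, ‖ℓ v‖ ≤ K * ‖A v‖) :
    ∃ y : H, ‖y‖ ≤ K ∧ ∀ v, ℓ v = inner ℂ y (A v) := by
  have hker : LinearMap.ker A ≤ LinearMap.ker ℓ := by
    intro v hv
    have := h v
    rw [LinearMap.mem_ker.1 hv, norm_zero, mul_zero] at this
    exact LinearMap.mem_ker.2 (norm_le_zero_iff.1 this)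
  obtain ⟨g, hg⟩ : ∃ g : LinearMap.range A →ₗ[ℂ] ℂ, ∀ v, g ⟨A v, v, rfl⟩ = ℓ v := by
    refine ⟨(Submodule.liftQ _ ℓ hker).comp (A.quotKerEquivRange.symm : _ →ₗ[ℂ] _), fun v => ?_⟩
    have : A.quotKerEquivRange.symm ⟨A v, v, rfl⟩ = Submodule.Quotient.mk v := by
      rw [LinearEquiv.symm_apply_eq]
      exact Subtype.ext (by simp [LinearMap.quotKerEquivRange_apply_mk])
    simp [this]
  have hgb : ∀ x, ‖g x‖ ≤ K * ‖x‖ := by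
    rintro ⟨_, v, rfl⟩
    rw [hg]
    exact h v
  obtain ⟨Φ, hΦ, hn⟩ := exists_extension_norm_eq (LinearMap.range A) (g.mkContinuous K hgb)
  refine ⟨(InnerProductSpace.toDual ℂ H).symm Φ, ?_, fun v => ?_⟩
  · rw [LinearIsometryEquiv.norm_map, hn]
    exact LinearMap.mkContinuous_norm_le _ hK _
  · rw [InnerProductSpace.toDual_symm_apply, ← hg]
    exact (hΦ ⟨A v, v, rfl⟩).symm

/-- Uniformly bounded solutions of all finite subsystems give a solution of the whole system, with
no countability of J. On finite combinations the functional Σ c_j a_j ↦ Σ c_j conj(b_j) is given by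
some f of norm at most M, hence is bounded by M. -/
theorem exists_inner_eq_of_forall_finset {J : Type*} (a : J → H) (b : J → ℂ) {M : ℝ}
    (hM : 0 ≤ M) (h : ∀ s : Finset J, ∃ f : H, ‖f‖ ≤ M ∧ ∀ j ∈ s, inner ℂ (a j) f = b j) :
    ∃ f : H, ‖f‖ ≤ M ∧ ∀ j, inner ℂ (a j) f = b j := by
  obtain ⟨y, hy, hy2⟩ := exists_inner_eq_of_norm_le (Finsupp.linearCombination ℂ a)
    (Finsupp.linearCombination ℂ fun j => (starRingEnd ℂ) (b j)) hM (by
      intro c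
      obtain ⟨f, hf, hfb⟩ := h c.support
      have : Finsupp.linearCombination ℂ (fun j => (starRingEnd ℂ) (b j)) c =
          inner ℂ f (Finsupp.linearCombination ℂ a c) := by
        rw [Finsupp.linearCombination_apply, Finsupp.linearCombination_apply, Finsupp.sum,
          Finsupp.sum, inner_sum]
        refine Finset.sum_congr rfl fun j hj => ?_
        rw [inner_smul_right, ← hfb j hj, inner_conj_symm, smul_eq_mul]
      rw [this]
      exact (norm_inner_le_norm _ _).trans (by gcongr))
  refine ⟨y, hy, fun j => ?_⟩
  have := hy2 (Finsupp.single j 1)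
  simp only [Finsupp.linearCombination_single, one_smul] at this
  rw [← inner_conj_symm, ← this, Complex.conj_conj]

end Riesz

/-! ### Weak solutions of `∂̄w = h` with weighted estimates -/

section L2

open ComplexConjugate

variable {X : Type*} [MeasurableSpace X] {μ : Measure X} {f g : X → ℂ}

theorem inner_toLp_toLp (hf : MemLp f 2 μ) (hg : MemLp g 2 μ) :
    inner ℂ (hf.toLp f) (hg.toLp g) = ∫ x, conj (f x) * g x ∂μ := by
  rw [L2.inner_def]
  refine integral_congr_ae ?_
  filter_upwards [hf.coeFn_toLp, hg.coeFn_toLp] with x h1 h2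
  rw [h1, h2, RCLike.inner_apply, mul_comm]

theorem norm_toLp_two_sq (hf : MemLp f 2 μ) : ‖hf.toLp f‖ ^ 2 = ∫ x, ‖f x‖ ^ 2 ∂μ := by
  have h1 : ((‖hf.toLp f‖ ^ 2 : ℝ) : ℂ) = inner ℂ (hf.toLp f) (hf.toLp f) := by
    rw [inner_self_eq_norm_sq_to_K]; norm_cast
  rw [inner_toLp_toLp] at h1
  simp_rw [Complex.conj_mul'] at h1
  have h2 : ∀ x, ((‖f x‖ : ℂ)) ^ 2 = ((‖f x‖ ^ 2 : ℝ) : ℂ) := by intro x; norm_cast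
  simp_rw [h2] at h1
  rw [integral_complex_ofReal] at h1
  exact_mod_cast h1

theorem memLp_two_conj (hf : MemLp f 2 μ) : MemLp (fun x => conj (f x)) 2 μ := by
  refine hf.of_le (Complex.continuous_conj.comp_aestronglyMeasurable hf.1) ?_
  filter_upwards with x
  simp

theorem norm_integral_mul_le_of_memLp (hf : MemLp f 2 μ) (hg : MemLp g 2 μ) :
    ‖∫ x, f x * g x ∂μ‖ ≤ Real.sqrt (∫ x, ‖f x‖ ^ 2 ∂μ) * Real.sqrt (∫ x, ‖g x‖ ^ 2 ∂μ) := by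
  have h := norm_inner_le_norm (𝕜 := ℂ) ((memLp_two_conj hf).toLp _) (hg.toLp g)
  rw [inner_toLp_toLp] at h
  simp only [Complex.conj_conj] at h
  refine h.trans (le_of_eq ?_)
  rw [← Real.sqrt_sq (norm_nonneg ((memLp_two_conj hf).toLp _)),
    ← Real.sqrt_sq (norm_nonneg (hg.toLp g)), norm_toLp_two_sq, norm_toLp_two_sq]
  simp

theorem integrable_mul_of_memLp_two (hf : MemLp f 2 μ) (hg : MemLp g 2 μ) :
    Integrable (fun x => f x * g x) μ :=
  hf.integrable_mul hg

end L2

section Solve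

open ComplexConjugate
open scoped ContDiff

/-- Smooth compactly supported complex functions on the plane. -/
def testSubmodule : Submodule ℂ (ℂ → ℂ) where
  carrier := {χ | ContDiff ℝ ∞ χ ∧ HasCompactSupport χ}
  add_mem' h1 h2 := ⟨h1.1.add h2.1, h1.2.add h2.2⟩
  zero_mem' := ⟨contDiff_const, HasCompactSupport.zero⟩
  smul_mem' c _ h := ⟨h.1.const_smul c, h.2.smul_left (f := fun _ => c)⟩

theorem dbar_add {f g : ℂ → ℂ} (hf : Differentiable ℝ f) (hg : Differentiable ℝ g) :
    dbar (f + g) = dbar f + dbar g := by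
  ext z
  exact ((HasWirtinger.of_differentiableAt (hf z)).add
    (HasWirtinger.of_differentiableAt (hg z))).dbar_eq

theorem dbar_const_smul {f : ℂ → ℂ} (hf : Differentiable ℝ f) (c : ℂ) :
    dbar (c • f) = c • dbar f := by
  ext z
  exact (((HasWirtinger.const c).mul
    (HasWirtinger.of_differentiableAt (hf z))).congr rfl (by simp)).dbar_eq

theorem memLp_dbar_mul {ρ : ℂ → ℂ} (hρ : Continuous ρ) (χ : testSubmodule) :
    MemLp (fun z => dbar χ.1 z * ρ z) 2 (volume : Measure ℂ) :=
  Continuous.memLp_of_hasCompactSupport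
    ((dbar_continuous (χ.2.1.of_le (by norm_cast))).mul hρ) χ.2.2.dbar.mul_right

/-- A linear map on test functions given by `χ ↦ ∂̄χ · ρ` for a continuous density `ρ`. -/
noncomputable def dbarLp {ρ : ℂ → ℂ} (hρ : Continuous ρ) :
    testSubmodule →ₗ[ℂ] Lp ℂ 2 (volume : Measure ℂ) where
  toFun χ := (memLp_dbar_mul hρ χ).toLp _
  map_add' χ ψ := by
    rw [← MemLp.toLp_add]
    refine MemLp.toLp_congr _ _ (Filter.Eventually.of_forall fun z => ?_)
    simp only [Submodule.coe_add, Pi.add_apply]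
    rw [dbar_add (χ.2.1.differentiable (by simp)) (ψ.2.1.differentiable (by simp))]
    simp [add_mul]
  map_smul' c χ := by
    rw [RingHom.id_apply, ← MemLp.toLp_const_smul]
    refine MemLp.toLp_congr _ _ (Filter.Eventually.of_forall fun z => ?_)
    simp only [Submodule.coe_smul, Pi.smul_apply]
    rw [dbar_const_smul (χ.2.1.differentiable (by simp))]
    simp [mul_assoc]

theorem dbarLp_apply {ρ : ℂ → ℂ} (hρ : Continuous ρ) (χ : testSubmodule) :
    dbarLp hρ χ = (memLp_dbar_mul hρ χ).toLp _ := rfl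

variable {G Q : ℂ → ℝ} {p : ℂ → ℂ}

/-- `L²` solvability of `∂̄w = h` in the weak sense with respect to the weight `1/G`. -/
theorem exists_weak_dbar_solution (hG0 : ∀ z, 0 < G z)
    (hG : ∀ z, HasWirtinger (fun w => (G w : ℂ)) (p z * G z) (conj (p z) * G z) z)
    (hp : ContDiff ℝ 1 p) (hQ : ∀ z, dbar p z = Q z) (hQ0 : ∀ z, 0 ≤ Q z)
    {α : ℝ} (hα : 0 < α) {h : ℂ → ℂ} (hm : AEStronglyMeasurable h volume)
    (hQα : ∀ z, h z ≠ 0 → α ≤ Q z) (hi : Integrable fun z => ‖h z‖ ^ 2 / G z) :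
    ∃ w : ℂ → ℂ, AEStronglyMeasurable w volume ∧ Integrable (fun z => ‖w z‖ ^ 2 / G z) ∧
      ∫ z, ‖w z‖ ^ 2 / G z ≤ α⁻¹ * ∫ z, ‖h z‖ ^ 2 / G z ∧
      ∀ χ : ℂ → ℂ, ContDiff ℝ ∞ χ → HasCompactSupport χ →
        ∫ z, w z * dbar χ z = - ∫ z, h z * χ z := by
  have hGc : Continuous (fun w => (G w : ℂ)) :=
    continuous_iff_continuousAt.2 fun z => (hG z).differentiableAt.continuousAt
  have hGr : Continuous G := Complex.continuous_re.comp hGc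
  have hQc : Continuous Q := by
    have h1 : Continuous fun z => ((Q z : ℝ) : ℂ) := by
      simp_rw [← hQ]
      exact dbar_continuous hp
    exact Complex.continuous_re.comp h1
  have hρ : Continuous (fun z => ((Real.sqrt (G z) : ℝ) : ℂ)) := by fun_prop
  -- The pairing ∫ hχ is split as h/√(QG) times χ√(QG). Q may vanish, but only where h does, and
  -- there the division by zero returns the harmless value 0.
  set h1 : ℂ → ℂ := fun z => h z / ((Real.sqrt (Q z * G z) : ℝ) : ℂ) with hh1
  have h1le : ∀ z, ‖h1 z‖ ^ 2 ≤ α⁻¹ * (‖h z‖ ^ 2 / G z) := by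
    intro z
    by_cases hz : h z = 0
    · simp [hh1, hz]
    have hq := hQα z hz
    rw [hh1, norm_div, div_pow, Complex.norm_real, Real.norm_eq_abs, sq_abs,
      Real.sq_sqrt (mul_nonneg (hQ0 z) (hG0 z).le), inv_mul_eq_div, div_div]
    have := hG0 z
    rw [mul_comm (G z)]
    gcongr
  have h1m : AEStronglyMeasurable h1 volume := by
    have : h1 = fun z => h z * (((Real.sqrt (Q z * G z))⁻¹ : ℝ) : ℂ) := by
      ext z; simp [hh1, div_eq_mul_inv]
    rw [this]
    refine hm.mul (Measurable.aestronglyMeasurable ?_)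
    have := hQc.measurable
    have := hGr.measurable
    fun_prop
  have h1i : Integrable (fun z => ‖h1 z‖ ^ 2) := by
    refine (hi.const_mul α⁻¹).mono (h1m.norm.pow 2) (Filter.Eventually.of_forall fun z => ?_)
    rw [Real.norm_of_nonneg (by positivity)]
    exact (h1le z).trans (le_abs_self _)
  have h1L : MemLp h1 2 volume := (memLp_two_iff_integrable_sq_norm h1m).2 h1i
  have hχL : ∀ χ : testSubmodule,
      MemLp (fun z => χ.1 z * ((Real.sqrt (Q z * G z) : ℝ) : ℂ)) 2 volume := by
    intro χ
    have := χ.2.1.continuous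
    exact Continuous.memLp_of_hasCompactSupport (by fun_prop) χ.2.2.mul_right
  have hprod : ∀ (χ : testSubmodule) z,
      h z * χ.1 z = h1 z * (χ.1 z * ((Real.sqrt (Q z * G z) : ℝ) : ℂ)) := by
    intro χ z
    by_cases hz : h z = 0
    · simp [hh1, hz]
    have h2 : 0 < Real.sqrt (Q z * G z) :=
      Real.sqrt_pos.2 (mul_pos (hα.trans_le (hQα z hz)) (hG0 z))
    have h3 : ((Real.sqrt (Q z * G z) : ℝ) : ℂ) ≠ 0 := by exact_mod_cast h2.ne'
    simp only [hh1]
    field_simp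
  have hint : ∀ χ : testSubmodule, Integrable (fun z => h z * χ.1 z) := by
    intro χ
    simp_rw [hprod]
    exact integrable_mul_of_memLp_two h1L (hχL χ)
  let ℓ : testSubmodule →ₗ[ℂ] ℂ :=
    { toFun := fun χ => -∫ z, h z * χ.1 z
      map_add' := fun χ ψ => by
        rw [← neg_add, ← integral_add (hint χ) (hint ψ)]
        simp [mul_add]
      map_smul' := fun c χ => by
        rw [RingHom.id_apply, smul_neg, smul_eq_mul, ← integral_const_mul]
        simp [mul_left_comm] }
  have hbound : ∀ χ, ‖ℓ χ‖ ≤ Real.sqrt (α⁻¹ * ∫ z, ‖h z‖ ^ 2 / G z) * ‖dbarLp hρ χ‖ := by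
    intro χ
    have e1 : ‖ℓ χ‖ = ‖∫ z, h1 z * (χ.1 z * ((Real.sqrt (Q z * G z) : ℝ) : ℂ))‖ := by
      change ‖-∫ z, h z * χ.1 z‖ = _
      simp_rw [hprod, norm_neg]
    rw [e1]
    refine (norm_integral_mul_le_of_memLp h1L (hχL χ)).trans ?_
    gcongr
    · rw [← integral_const_mul]
      exact integral_mono h1i (hi.const_mul _) h1le
    · refine Real.sqrt_le_iff.2 ⟨norm_nonneg _, ?_⟩
      have e2 := integral_laplacian_mul_le (fun z => (hG0 z).le) hG hp hQ
        (χ.2.1.of_le (by norm_cast)) χ.2.2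
      have e3 : ‖dbarLp hρ χ‖ ^ 2 = ∫ z, ‖dbar χ.1 z‖ ^ 2 * G z := by
        rw [dbarLp_apply, norm_toLp_two_sq]
        refine integral_congr_ae (Filter.Eventually.of_forall fun z => ?_)
        simp only [norm_mul, Complex.norm_real, Real.norm_eq_abs, mul_pow, sq_abs,
          Real.sq_sqrt (hG0 z).le]
      rw [e3]
      refine le_trans (le_of_eq ?_) e2
      refine integral_congr_ae (Filter.Eventually.of_forall fun z => ?_)
      simp only [norm_mul, Complex.norm_real, Real.norm_eq_abs, mul_pow, sq_abs,
        Real.sq_sqrt (mul_nonneg (hQ0 z) (hG0 z).le)]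
      ring
  obtain ⟨y, hy, hy2⟩ := exists_inner_eq_of_norm_le (dbarLp hρ) ℓ (Real.sqrt_nonneg _) hbound
  have hyL : MemLp (y : ℂ → ℂ) 2 volume := Lp.memLp y
  have hsq : ∀ z, ‖conj (y z) * ((Real.sqrt (G z) : ℝ) : ℂ)‖ ^ 2 / G z = ‖y z‖ ^ 2 := by
    intro z
    have := hG0 z
    simp only [norm_mul, Complex.norm_real, Real.norm_eq_abs, mul_pow, sq_abs,
        Real.sq_sqrt (hG0 z).le, RCLike.norm_conj]
    field_simp
  have hyn : ‖y‖ ^ 2 = ∫ z, ‖y z‖ ^ 2 := by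
    rw [← norm_toLp_two_sq hyL, Lp.toLp_coeFn]
  -- y represents the functional on the vectors ∂̄χ·√G, so the factor √G has to be moved onto the
  -- solution.
  refine ⟨fun z => conj (y z) * ((Real.sqrt (G z) : ℝ) : ℂ),
    (Complex.continuous_conj.comp_aestronglyMeasurable hyL.1).mul hρ.aestronglyMeasurable, ?_, ?_,
    fun χ hχ hc => ?_⟩
  · simp_rw [hsq]
    exact (memLp_two_iff_integrable_sq_norm hyL.1).1 hyL
  · simp_rw [hsq]
    rw [← hyn]
    refine (pow_le_pow_left₀ (norm_nonneg _) hy 2).trans (le_of_eq (Real.sq_sqrt ?_))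
    exact mul_nonneg (by positivity)
      (integral_nonneg fun z => div_nonneg (by positivity) (hG0 z).le)
  · have := hy2 ⟨χ, hχ, hc⟩
    change -∫ z, h z * χ z = _ at this
    rw [this]
    have e2 := inner_toLp_toLp hyL (memLp_dbar_mul hρ ⟨χ, hχ, hc⟩)
    rw [Lp.toLp_coeFn] at e2
    rw [dbarLp_apply, e2]
    refine integral_congr_ae (Filter.Eventually.of_forall fun z => ?_)
    simp only
    ring

end Solve

/-! ### Radial means of entire functions -/

section Radial

theorem integral_circle_mul {E : Type*} [NormedAddCommGroup E] [NormedSpace ℝ E]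
    {f : ℂ → E} {c : ℂ} (hc : ‖c‖ = 1) : ∫ z, f (c * z) = ∫ z, f z := by
  let a : Circle := ⟨c, mem_sphere_zero_iff_norm.2 hc⟩
  exact (rotation a).measurePreserving.integral_comp
    (rotation a).toHomeomorph.measurableEmbedding f

theorem integrable_circle_mul {f : ℂ → ℂ} {c : ℂ} (hc : ‖c‖ = 1) (hf : Integrable f) :
    Integrable fun z => f (c * z) := by
  let a : Circle := ⟨c, mem_sphere_zero_iff_norm.2 hc⟩
  exact (rotation a).measurePreserving.integrable_comp_of_integrable hf

/-- The mean value property with respect to a radial density. -/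
theorem integral_mul_radial {J : ℂ → ℂ} {η : ℝ → ℂ} (hJ : Differentiable ℂ J) (hη : Measurable η)
    (hi : Integrable fun z => J z * η ‖z‖) :
    ∫ z, J z * η ‖z‖ = J 0 * ∫ z : ℂ, η ‖z‖ := by
  have hn : ∀ θ : ℝ, ‖circleMap 0 1 θ‖ = 1 := by intro θ; simp
  -- The integral is unchanged when J is rotated. Averaging over θ and applying Fubini replaces J by
  -- its circle means, all equal to J 0.
  have h1 : ∀ θ : ℝ, ∫ z, J (circleMap 0 1 θ * z) * η ‖z‖ = ∫ z, J z * η ‖z‖ := by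
    intro θ
    rw [← integral_circle_mul (f := fun z => J z * η ‖z‖) (hn θ)]
    simp [hn]
  have h1i : ∀ θ : ℝ, Integrable fun z => J (circleMap 0 1 θ * z) * η ‖z‖ := by
    intro θ
    have := integrable_circle_mul (f := fun z => J z * η ‖z‖) (hn θ) hi
    simpa [hn] using this
  have h1n : ∀ θ : ℝ, ∫ z, ‖J (circleMap 0 1 θ * z) * η ‖z‖‖ = ∫ z, ‖J z * η ‖z‖‖ := by
    intro θ
    rw [← integral_circle_mul (f := fun z => ‖J z * η ‖z‖‖) (hn θ)]
    simp [hn]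
  have hint : Integrable (Function.uncurry fun (θ : ℝ) (z : ℂ) => J (circleMap 0 1 θ * z) * η ‖z‖)
      ((volume.restrict (Set.uIoc 0 (2 * Real.pi))).prod volume) := by
    rw [integrable_prod_iff]
    · refine ⟨Filter.Eventually.of_forall fun θ => h1i θ, ?_⟩
      simp only [Function.uncurry_apply_pair, h1n]
      have : IsFiniteMeasure (volume.restrict (Set.uIoc 0 (2 * Real.pi))) :=
        isFiniteMeasure_restrict.2 (by simp [Set.uIoc])
      exact integrable_const _
    · refine AEStronglyMeasurable.mul ?_ ?_
      · have := hJ.continuous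
        exact Continuous.aestronglyMeasurable (by fun_prop)
      · exact (Measurable.aestronglyMeasurable (by fun_prop))
  have h2 := intervalIntegral_integral_swap hint
  simp only [h1, intervalIntegral.integral_const, intervalIntegral.integral_mul_const] at h2
  have h3 : ∀ z, ∫ θ in (0 : ℝ)..(2 * Real.pi), J (circleMap 0 1 θ * z) = 2 * Real.pi * J 0 := by
    intro z
    have := (DiffContOnCl.circleAverage (f := fun w => J (w * z)) (c := 0) (R := 1)
      (by
        have : Differentiable ℂ fun w => J (w * z) := hJ.comp (by fun_prop)
        exact this.diffContOnCl))
    rw [Real.circleAverage_def, zero_mul] at this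
    rw [← this]
    have hpi := Real.pi_ne_zero
    rw [Complex.real_smul]
    push_cast
    rw [← mul_assoc, mul_inv_cancel₀ (by simp [Real.pi_ne_zero]), one_mul]
  simp_rw [h3] at h2
  rw [integral_const_mul] at h2
  have h4 : (2 * Real.pi : ℂ) ≠ 0 := by simp [Real.pi_ne_zero]
  apply mul_left_cancel₀ h4
  rw [← mul_assoc, ← h2]
  simp

end Radial

/-! ### Weakly holomorphic functions -/

section Weyl

open ContinuousLinearMap Filter
open scoped ContDiff Topology

variable {g : ℂ → ℂ}

/-- The weak equation tested against t ↦ ρ(x - t) is the Cauchy–Riemann equation of the convolution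
at x. -/
theorem differentiable_convolution_of_weak (hg : LocallyIntegrable g volume)
    (h : ∀ χ : ℂ → ℂ, ContDiff ℝ ∞ χ → HasCompactSupport χ → ∫ z, g z * dbar χ z = 0)
    {ρ : ℂ → ℝ} (hρ : ContDiff ℝ ∞ ρ) (hc : HasCompactSupport ρ) :
    Differentiable ℂ (convolution ρ g (lsmul ℝ ℝ) volume) := by
  intro x
  rw [← convolution_flip]
  have hρ1 : ContDiff ℝ 1 ρ := hρ.of_le (by norm_cast)
  have hd := HasCompactSupport.hasFDerivAt_convolution_right
    (lsmul ℝ ℝ : ℝ →L[ℝ] ℂ →L[ℝ] ℂ).flip hc hg hρ1 x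
  have happ := convolution_precompR_apply (lsmul ℝ ℝ : ℝ →L[ℝ] ℂ →L[ℝ] ℂ).flip hg
    (hc.fderiv ℝ) (hρ1.continuous_fderiv one_ne_zero) x
  refine differentiableAt_complex_iff_differentiableAt_real.2 ⟨hd.differentiableAt, ?_⟩
  rw [hd.fderiv, happ, happ]
  set χ : ℂ → ℂ := fun t => (ρ (x - t) : ℂ) with hχ
  have hχs : ContDiff ℝ ∞ χ :=
    Complex.ofRealCLM.contDiff.comp (hρ.comp (contDiff_const.sub contDiff_id))
  have hχc : HasCompactSupport χ := by
    have h1 : HasCompactSupport fun t => ρ (x - t) :=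
      hc.comp_homeomorph (Homeomorph.subLeft x)
    exact h1.comp_left (g := ((↑) : ℝ → ℂ)) (by simp)
  have h0 := h χ hχs hχc
  have hf : ∀ t v, fderiv ℝ χ t v = -((fderiv ℝ ρ (x - t) v : ℝ) : ℂ) := by
    intro t v
    have e1 : HasFDerivAt (fun t : ℂ => x - t) (-(ContinuousLinearMap.id ℝ ℂ)) t := by
      simpa using (hasFDerivAt_id (𝕜 := ℝ) t).const_sub x
    have e2 := (hρ1.differentiable one_ne_zero (x - t)).hasFDerivAt.comp t e1
    have e3 := Complex.ofRealCLM.hasFDerivAt.comp t e2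
    have e4 : HasFDerivAt χ _ t := e3
    rw [e4.fderiv]
    simp
  have hint : ∀ v, Integrable fun t => g t * ((fderiv ℝ ρ (x - t) v : ℝ) : ℂ) := by
    intro v
    have e1 : HasCompactSupport fun a => fderiv ℝ ρ a v := hc.fderiv_apply ℝ v
    have e2 := (e1.convolutionExists_right (lsmul ℝ ℝ : ℝ →L[ℝ] ℂ →L[ℝ] ℂ).flip hg
      ((hρ1.continuous_fderiv one_ne_zero).clm_apply continuous_const)) x
    refine (integrable_congr (Eventually.of_forall fun t => ?_)).1 e2
    simp [mul_comm]
  have e3 : ∀ t, g t * dbar χ t = -(1 / 2 : ℂ) * (g t * ((fderiv ℝ ρ (x - t) 1 : ℝ) : ℂ)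
      + Complex.I * (g t * ((fderiv ℝ ρ (x - t) Complex.I : ℝ) : ℂ))) := by
    intro t
    rw [dbar, hf, hf]
    ring
  simp_rw [e3] at h0
  rw [integral_const_mul, integral_add (hint 1) ((hint _).const_mul _), integral_const_mul] at h0
  have e4 : ∀ v, convolution g (fun a => fderiv ℝ ρ a v)
      (lsmul ℝ ℝ : ℝ →L[ℝ] ℂ →L[ℝ] ℂ).flip volume x =
      ∫ t, g t * ((fderiv ℝ ρ (x - t) v : ℝ) : ℂ) := by
    intro v
    rw [convolution_def]
    simp [mul_comm]
  rw [e4, e4, smul_eq_mul]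
  have e5 := (mul_eq_zero.1 h0).resolve_left (by norm_num)
  linear_combination (-Complex.I) * e5 + (∫ t, g t * ((fderiv ℝ ρ (x - t) Complex.I : ℝ) : ℂ)) * Complex.I_mul_I

/-- A radial mollifier of total mass one. -/
theorem exists_radial_mollifier : ∃ η : ℝ → ℝ, Measurable η ∧
    ContDiff ℝ ∞ (fun z : ℂ => η ‖z‖) ∧ HasCompactSupport (fun z : ℂ => η ‖z‖) ∧
    ∫ z : ℂ, η ‖z‖ = 1 := by
  set u : ℂ → ℝ := fun z => Real.smoothTransition (1 - ‖z‖ ^ 2) with hu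
  have h1 : ContDiff ℝ ∞ u := Real.smoothTransition.contDiff.comp
    (contDiff_const.sub (contDiff_norm_sq ℝ))
  have h2 : HasCompactSupport u := by
    refine HasCompactSupport.of_support_subset_isCompact (isCompact_closedBall (0 : ℂ) 1) ?_
    intro z hz
    by_contra hz'
    rw [mem_closedBall_zero_iff, not_le] at hz'
    exact hz (Real.smoothTransition.zero_of_nonpos (by nlinarith))
  have h3 : 0 < ∫ z, u z := by
    rw [integral_pos_iff_support_of_nonneg (fun z => Real.smoothTransition.nonneg _)
      (h1.continuous.integrable_of_hasCompactSupport h2)]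
    refine (Metric.measure_ball_pos volume (0 : ℂ) one_pos).trans_le (measure_mono ?_)
    intro z hz
    rw [mem_ball_zero_iff] at hz
    exact (Real.smoothTransition.pos_of_pos (by nlinarith [norm_nonneg z])).ne'
  refine ⟨fun r => (∫ z, u z)⁻¹ * Real.smoothTransition (1 - r ^ 2), ?_, ?_, ?_, ?_⟩
  · have := Real.smoothTransition.continuous.measurable
    fun_prop
  · exact contDiff_const.mul h1
  · exact h2.mul_left
  · rw [integral_const_mul]
    exact inv_mul_cancel₀ h3.ne'

/-- Weyl's lemma by mollification. For an approximate identity ψ_n, the function ψ_n * g is entire,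
so the mean value property gives ρ * (ψ_n * g) = ψ_n * g for the fixed radial ρ. Thus ψ_n * g = ψ_n
* (ρ * g), and letting n → ∞ shows g = ρ * g almost everywhere, where ρ * g is entire. -/
theorem exists_entire_ae_eq (hg : LocallyIntegrable g volume)
    (h : ∀ χ : ℂ → ℂ, ContDiff ℝ ∞ χ → HasCompactSupport χ → ∫ z, g z * dbar χ z = 0) :
    ∃ F : ℂ → ℂ, Differentiable ℂ F ∧ g =ᵐ[volume] F := by
  obtain ⟨η, hηm, hηs, hηc, hη1⟩ := exists_radial_mollifier
  set ρ : ℂ → ℝ := fun z => η ‖z‖ with hρ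
  refine ⟨convolution ρ g (lsmul ℝ ℝ) volume, differentiable_convolution_of_weak hg h hηs hηc, ?_⟩
  let φ : ℕ → ContDiffBump (0 : ℂ) := fun n =>
    ⟨1 / (n + 1), 2 / (n + 1), by positivity, by gcongr; norm_num⟩
  have hφ : Tendsto (fun n => (φ n).rOut) atTop (𝓝 0) := by
    have := (tendsto_one_div_add_atTop_nhds_zero_nat (𝕜 := ℝ)).const_mul 2
    simpa [φ, div_eq_mul_inv] using this
  have hlim := ContDiffBump.ae_convolution_tendsto_right_of_locallyIntegrable (μ := volume)
    (K := 2) hφ (Eventually.of_forall fun n => by simp only [φ]; rw [mul_one_div]) hg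
  have hcont : Continuous (convolution ρ g (lsmul ℝ ℝ) volume) :=
    hηc.continuous_convolution_left _ hηs.continuous hg
  have key : ∀ n, convolution ((φ n).normed volume) g (lsmul ℝ ℝ) volume =
      convolution ((φ n).normed volume) (convolution ρ g (lsmul ℝ ℝ) volume)
        (lsmul ℝ ℝ) volume := by
    intro n
    set ψ := (φ n).normed volume with hψ
    have hψs : ContDiff ℝ ∞ ψ := (φ n).contDiff_normed
    have hψc : HasCompactSupport ψ := (φ n).hasCompactSupport_normed
    have assoc : ∀ {a b : ℂ → ℝ}, Continuous a → HasCompactSupport a → Continuous b →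
        HasCompactSupport b → ∀ x, convolution (convolution a b (mul ℝ ℝ) volume) g
          (lsmul ℝ ℝ) volume x =
          convolution a (convolution b g (lsmul ℝ ℝ) volume) (lsmul ℝ ℝ) volume x := by
      intro a b ha hac hb hbc x
      refine convolution_assoc (mul ℝ ℝ) (lsmul ℝ ℝ) (lsmul ℝ ℝ) (lsmul ℝ ℝ)
        (fun x y z => by simp [mul_assoc]) ha.aestronglyMeasurable hb.aestronglyMeasurable
        hg.aestronglyMeasurable (Eventually.of_forall fun y => ?_)
        (Eventually.of_forall fun y => ?_) ?_
      · exact hac.convolutionExists_left _ ha hb.locallyIntegrable y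
      · exact hbc.norm.convolutionExists_left _ hb.norm (fun x => (hg x).norm) y
      · refine hac.norm.convolutionExists_left _ ha.norm (Continuous.locallyIntegrable ?_) x
        exact hbc.norm.continuous_convolution_left _ hb.norm (fun x => (hg x).norm)
    ext1 x
    rw [← assoc hψs.continuous hψc hηs.continuous hηc, ← convolution_flip (mul ℝ ℝ), flip_mul,
      assoc hηs.continuous hηc hψs.continuous hψc]
    have hd := differentiable_convolution_of_weak hg h hψs hψc
    set G := convolution ψ g (lsmul ℝ ℝ) volume with hG
    have hJ : Differentiable ℂ fun t => G (x - t) := hd.comp (by fun_prop)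
    have := integral_mul_radial (η := fun r => (η r : ℂ)) hJ (by fun_prop) (by
      refine Continuous.integrable_of_hasCompactSupport (hJ.continuous.mul ?_) ?_
      · exact Complex.continuous_ofReal.comp hηs.continuous
      · exact HasCompactSupport.mul_left (hηc.comp_left (g := ((↑) : ℝ → ℂ)) (by simp)))
    rw [integral_complex_ofReal, hη1] at this
    have e : ∫ t, lsmul ℝ ℝ (ρ t) (G (x - t)) = ∫ t, G (x - t) * ((η ‖t‖ : ℝ) : ℂ) :=
      integral_congr_ae (Eventually.of_forall fun t => by simp [hρ, mul_comm])
    have e' : convolution ρ G (lsmul ℝ ℝ) volume x = G x := by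
      rw [convolution_def, e, this]
      simp
    exact e'.symm
  filter_upwards [hlim] with x hx
  simp_rw [key] at hx
  exact tendsto_nhds_unique hx
    (ContDiffBump.convolution_tendsto_right_of_continuous (μ := volume) hφ hcont x)

end Weyl

/-! ### Basic facts on the Fock space -/

namespace Fock

open ComplexConjugate

variable {α : ℝ} {f g : ℂ → ℂ}

/-- The isometric embedding `f ↦ √(α/π) f exp(-α|z|²/2)` of the Fock space in `L²`. -/
noncomputable def gaussMul (α : ℝ) (f : ℂ → ℂ) (z : ℂ) : ℂ :=
  f z * ((Real.sqrt (α / Real.pi) * Real.exp (-α / 2 * ‖z‖ ^ 2) : ℝ) : ℂ)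

theorem gaussMul_mul_conj (hα : 0 ≤ α) (f g : ℂ → ℂ) (z : ℂ) :
    conj (gaussMul α g z) * gaussMul α f z =
      ((α / Real.pi : ℝ) : ℂ) * (f z * conj (g z) * ((Real.exp (-α * ‖z‖ ^ 2) : ℝ) : ℂ)) := by
  have h1 : Real.exp (-α * ‖z‖ ^ 2) = Real.exp (-α / 2 * ‖z‖ ^ 2) ^ 2 := by
    rw [← Real.exp_nat_mul]; congr 1; push_cast; ring
  have h2 : Real.sqrt (α / Real.pi) ^ 2 = α / Real.pi := Real.sq_sqrt (by positivity)
  have h3 : ((α / Real.pi : ℝ) : ℂ) = (Real.sqrt (α / Real.pi) : ℂ) ^ 2 := by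
    rw [← Complex.ofReal_pow, h2]
  rw [h1, gaussMul, gaussMul, h3]
  simp only [map_mul, Complex.conj_ofReal]
  push_cast
  ring

theorem norm_gaussMul_sq (hα : 0 ≤ α) (f : ℂ → ℂ) (z : ℂ) :
    ‖gaussMul α f z‖ ^ 2 = α / Real.pi * (‖f z‖ ^ 2 * Real.exp (-α * ‖z‖ ^ 2)) := by
  have h := gaussMul_mul_conj hα f f z
  rw [Complex.conj_mul', Complex.mul_conj'] at h
  exact_mod_cast h

theorem continuous_gaussMul (hf : Continuous f) : Continuous (gaussMul α f) := by
  unfold gaussMul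
  fun_prop

theorem Mem.memLp (hα : 0 ≤ α) (hf : Mem α f) : MemLp (gaussMul α f) 2 volume := by
  refine (memLp_two_iff_integrable_sq_norm
    (continuous_gaussMul hf.1.continuous).aestronglyMeasurable).2 ?_
  simp_rw [norm_gaussMul_sq hα]
  exact hf.2.const_mul _

theorem ip_eq_inner (hα : 0 ≤ α) (hf : Mem α f) (hg : Mem α g) :
    ip α f g = inner ℂ ((hg.memLp hα).toLp _) ((hf.memLp hα).toLp _) := by
  rw [inner_toLp_toLp, ip, ← integral_const_mul]
  simp_rw [gaussMul_mul_conj hα]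

theorem mem_of_memLp (hα : 0 < α) (hf : Differentiable ℂ f)
    (h : MemLp (gaussMul α f) 2 volume) : Mem α f := by
  refine ⟨hf, ?_⟩
  have := (memLp_two_iff_integrable_sq_norm h.1).1 h
  simp_rw [norm_gaussMul_sq hα.le] at this
  have hpi := Real.pi_pos
  refine (this.const_mul (α / Real.pi)⁻¹).congr (Filter.Eventually.of_forall fun z => ?_)
  simp only
  field_simp

/-- The Fock space as a submodule of the space of all functions. -/
def submodule (hα : 0 < α) : Submodule ℂ (ℂ → ℂ) where
  carrier := {f | Mem α f}
  add_mem' {f g} hf hg := mem_of_memLp hα (hf.1.add hg.1) (by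
    convert! (hf.memLp hα.le).add (hg.memLp hα.le) using 1
    ext z; simp [gaussMul, add_mul])
  zero_mem' := ⟨differentiable_const 0, by simp⟩
  smul_mem' c f hf := mem_of_memLp hα (hf.1.const_smul c) (by
    convert! (hf.memLp hα.le).const_smul c using 1
    ext z; simp [gaussMul, mul_assoc])

/-- The isometric embedding of the Fock space in `L²` as a linear map. -/
noncomputable def toL2 (hα : 0 < α) : submodule hα →ₗ[ℂ] Lp ℂ 2 (volume : Measure ℂ) where
  toFun f := (Mem.memLp hα.le f.2).toLp _
  map_add' f g := by
    rw [← MemLp.toLp_add]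
    exact MemLp.toLp_congr _ _ (Filter.Eventually.of_forall fun z => by simp [gaussMul, add_mul])
  map_smul' c f := by
    rw [RingHom.id_apply, ← MemLp.toLp_const_smul]
    exact MemLp.toLp_congr _ _ (Filter.Eventually.of_forall fun z => by simp [gaussMul, mul_assoc])

theorem toL2_apply (hα : 0 < α) (hf : Mem α f) :
    toL2 hα ⟨f, hf⟩ = (hf.memLp hα.le).toLp _ := rfl

theorem inner_toL2 (hα : 0 < α) (f g : submodule hα) :
    inner ℂ (toL2 hα g) (toL2 hα f) = ip α f g :=
  (ip_eq_inner hα.le f.2 g.2).symm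

theorem norm_toL2_sq (hα : 0 < α) (f : submodule hα) :
    ‖toL2 hα f‖ ^ 2 = α / Real.pi * ∫ z, ‖f.1 z‖ ^ 2 * Real.exp (-α * ‖z‖ ^ 2) := by
  obtain ⟨f, hf⟩ := f
  rw [toL2_apply hα hf, norm_toLp_two_sq, ← integral_const_mul]
  simp_rw [norm_gaussMul_sq hα.le]

theorem ip_conj_symm (hα : 0 < α) (hf : Mem α f) (hg : Mem α g) :
    conj (ip α f g) = ip α g f := by
  rw [ip_eq_inner hα.le hf hg, ip_eq_inner hα.le hg hf, inner_conj_symm]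

/-! #### Translations -/

theorem norm_T_sq (w : ℂ) (f : ℂ → ℂ) (z : ℂ) :
    ‖T α w f z‖ ^ 2 * Real.exp (-α * ‖z‖ ^ 2) =
      ‖f (z - w)‖ ^ 2 * Real.exp (-α * ‖z - w‖ ^ 2) := by
  rw [T, norm_mul, Complex.norm_exp, mul_pow, ← Real.exp_nat_mul, mul_right_comm, ← Real.exp_add,
    mul_comm]
  congr 2
  rw [← Complex.normSq_eq_norm_sq, ← Complex.normSq_eq_norm_sq, ← Complex.normSq_eq_norm_sq,
    Complex.normSq_apply, Complex.normSq_apply, Complex.normSq_apply]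
  simp
  ring

theorem T_mul_conj_T (w : ℂ) (f g : ℂ → ℂ) (z : ℂ) :
    T α w f z * conj (T α w g z) * ((Real.exp (-α * ‖z‖ ^ 2) : ℝ) : ℂ) =
      f (z - w) * conj (g (z - w)) * ((Real.exp (-α * ‖z - w‖ ^ 2) : ℝ) : ℂ) := by
  -- The case f = 1 computes the squared modulus of the exponential factor, which is all that is
  -- needed here.
  have h := norm_T_sq (α := α) w (fun _ => 1) z
  rw [T] at *
  simp only [mul_one, norm_one, one_pow, one_mul, T, map_mul] at h ⊢
  generalize Complex.exp (α * conj w * z - ((α / 2 * ‖w‖ ^ 2 : ℝ) : ℂ)) = E at h ⊢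
  rw [← h, Complex.ofReal_mul, Complex.ofReal_pow, ← Complex.mul_conj']
  ring

theorem Mem.T (hf : Mem α f) (w : ℂ) : Mem α (T α w f) := by
  refine ⟨?_, ?_⟩
  · have h1 : Differentiable ℂ fun z => f (z - w) := hf.1.comp (by fun_prop)
    exact Differentiable.mul (by fun_prop) h1
  · simp_rw [norm_T_sq]
    exact hf.2.comp_sub_right w

theorem ip_T_T (w : ℂ) (f g : ℂ → ℂ) : ip α (T α w f) (T α w g) = ip α f g := by
  unfold ip
  simp_rw [T_mul_conj_T]
  rw [integral_sub_right_eq_self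
    (fun z => f z * conj (g z) * ((Real.exp (-α * ‖z‖ ^ 2) : ℝ) : ℂ)) w]

theorem T_T_neg (w : ℂ) (f : ℂ → ℂ) : T α w (T α (-w) f) = f := by
  ext z
  have h0 : conj w * w = ((‖w‖ ^ 2 : ℝ) : ℂ) := by
    rw [Complex.conj_mul']; norm_cast
  simp only [T, ← mul_assoc, ← Complex.exp_add, sub_neg_eq_add, sub_add_cancel, norm_neg, map_neg]
  rw [show (α : ℂ) * conj w * z - ((α / 2 * ‖w‖ ^ 2 : ℝ) : ℂ) +
    (α * -conj w * (z - w) - ((α / 2 * ‖w‖ ^ 2 : ℝ) : ℂ)) = 0 by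
      push_cast at h0 ⊢
      linear_combination (α : ℂ) * h0]
  simp

theorem ip_T_right (w : ℂ) (f g : ℂ → ℂ) : ip α f (T α w g) = ip α (T α (-w) f) g := by
  rw [← ip_T_T w (T α (-w) f) g, T_T_neg]

/-! #### Monomials -/

theorem integral_norm_pow_mul_exp (hα : 0 < α) (k : ℕ) :
    ∫ z : ℂ, ‖z‖ ^ (2 * k) * Real.exp (-α * ‖z‖ ^ 2) =
      Real.pi * (Nat.factorial k) / α ^ (k + 1) := by
  have h := Complex.integral_rpow_mul_exp_neg_mul_rpow (p := 2) (q := ((2 * k : ℕ) : ℝ)) (b := α)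
    (by norm_num) (by have : (0 : ℝ) ≤ ((2 * k : ℕ) : ℝ) := by positivity
                      linarith) hα
  have e2 : ∀ x : ℝ, x ^ (2 : ℝ) = x ^ 2 := fun x => by exact_mod_cast Real.rpow_natCast x 2
  simp_rw [Real.rpow_natCast, e2] at h
  rw [h]
  have e3 : (((2 * k : ℕ) : ℝ) + 2) / 2 = k + 1 := by push_cast; ring
  have e4 : -((((2 * k : ℕ) : ℝ)) + 2) / 2 = -((k + 1 : ℕ) : ℝ) := by push_cast; ring
  rw [e3, e4, Real.Gamma_nat_eq_factorial, Real.rpow_neg hα.le, Real.rpow_natCast]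
  field_simp

theorem integrable_norm_pow_mul_exp (hα : 0 < α) (k : ℕ) :
    Integrable fun z : ℂ => ‖z‖ ^ (2 * k) * Real.exp (-α * ‖z‖ ^ 2) := by
  -- A non-integrable function has integral 0 by convention, whereas the computed value is positive.
  by_contra h
  have := integral_norm_pow_mul_exp hα k
  rw [integral_undef h] at this
  have hpos : 0 < Real.pi * (Nat.factorial k) / α ^ (k + 1) := by positivity
  exact hpos.ne this

theorem mem_e (hα : 0 < α) (k : ℕ) : Mem α (e α k) := by
  refine ⟨by unfold e; fun_prop, ?_⟩
  refine ((integrable_norm_pow_mul_exp hα k).const_mul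
    ((Real.sqrt (α ^ k) / Real.sqrt (Nat.factorial k : ℝ)) ^ 2)).congr
    (Filter.Eventually.of_forall fun z => ?_)
  simp only [e, norm_mul, norm_pow, Complex.norm_real, Real.norm_eq_abs]
  rw [mul_pow, sq_abs, ← pow_mul, mul_comm k 2]
  ring

theorem norm_e_sq (hα : 0 < α) (k : ℕ) (z : ℂ) :
    ‖e α k z‖ ^ 2 = (α * ‖z‖ ^ 2) ^ k / Nat.factorial k := by
  simp only [e, norm_mul, norm_pow, Complex.norm_real, Real.norm_eq_abs]
  rw [mul_pow, sq_abs, div_pow, Real.sq_sqrt (by positivity), Real.sq_sqrt (by positivity),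
    mul_pow]
  ring

theorem ip_e_self (hα : 0 < α) (k : ℕ) : ip α (e α k) (e α k) = 1 := by
  unfold ip
  have h : ∀ z, e α k z * conj (e α k z) * ((Real.exp (-α * ‖z‖ ^ 2) : ℝ) : ℂ) =
      ((α ^ k / Nat.factorial k * (‖z‖ ^ (2 * k) * Real.exp (-α * ‖z‖ ^ 2)) : ℝ) : ℂ) := by
    intro z
    rw [Complex.mul_conj']
    have := norm_e_sq hα k z
    have h2 : ((‖e α k z‖ : ℂ)) ^ 2 = ((‖e α k z‖ ^ 2 : ℝ) : ℂ) := by norm_cast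
    rw [h2, this]
    push_cast
    ring
  simp_rw [h]
  rw [integral_complex_ofReal, integral_const_mul, integral_norm_pow_mul_exp hα]
  have := Real.pi_pos
  have h3 := Nat.factorial_pos k
  rw [← Complex.ofReal_mul, ← Complex.ofReal_one]
  congr 1
  field_simp
  ring

/-- Since z^m conj(z)^k = z^(m-k) |z|^(2k), the integral is that of a holomorphic function vanishing
at 0 against a radial density. -/
theorem ip_pow_mul_e (hα : 0 < α) {L : ℂ → ℂ} (hL : Differentiable ℂ L) {m k : ℕ} (hk : k < m)
    (h : Mem α fun z => z ^ m * L z) : ip α (fun z => z ^ m * L z) (e α k) = 0 := by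
  have hint := integrable_mul_of_memLp_two (memLp_two_conj ((mem_e hα k).memLp hα.le))
    (h.memLp hα.le)
  set c : ℂ := ((Real.sqrt (α ^ k) / Real.sqrt (Nat.factorial k : ℝ) : ℝ) : ℂ) with hc
  have key : ∀ z : ℂ, z ^ m * L z * conj (e α k z) * ((Real.exp (-α * ‖z‖ ^ 2) : ℝ) : ℂ) =
      (z ^ (m - k) * L z) * (c * ((‖z‖ ^ (2 * k) * Real.exp (-α * ‖z‖ ^ 2) : ℝ) : ℂ)) := by
    intro z
    have e1 : z ^ m = z ^ (m - k) * z ^ k := by rw [← pow_add]; congr 1; omega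
    have e2 : z ^ k * conj z ^ k = ((‖z‖ ^ (2 * k) : ℝ) : ℂ) := by
      rw [← mul_pow, Complex.mul_conj', ← pow_mul]; norm_cast
    simp only [e, map_mul, map_pow, Complex.conj_ofReal]
    rw [Complex.ofReal_mul, ← e2, e1, ← hc]
    ring
  simp_rw [gaussMul_mul_conj hα.le, key] at hint
  have hpi := Real.pi_pos
  have hne : ((α / Real.pi : ℝ) : ℂ) ≠ 0 := by
    exact_mod_cast (div_pos hα hpi).ne'
  have hint2 := hint.const_mul ((α / Real.pi : ℝ) : ℂ)⁻¹
  simp_rw [inv_mul_cancel_left₀ hne] at hint2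
  have := integral_mul_radial (J := fun z => z ^ (m - k) * L z)
    (η := fun r => c * ((r ^ (2 * k) * Real.exp (-α * r ^ 2) : ℝ) : ℂ)) (by fun_prop)
    (by fun_prop) hint2
  rw [ip]
  simp_rw [key]
  rw [this, zero_pow (by omega)]
  simp

theorem ip_e_e (hα : 0 < α) (j k : ℕ) : ip α (e α j) (e α k) = if j = k then 1 else 0 := by
  have main : ∀ j k : ℕ, k < j → ip α (e α j) (e α k) = 0 := by
    intro j k h
    have hj : e α j = fun z => z ^ j *
        ((Real.sqrt (α ^ j) / Real.sqrt (Nat.factorial j : ℝ) : ℝ) : ℂ) := by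
      ext z; rw [e, mul_comm]
    have hm := mem_e hα j
    rw [hj] at hm ⊢
    exact ip_pow_mul_e hα (by fun_prop) h hm
  rcases lt_trichotomy j k with h | h | h
  · rw [if_neg h.ne, ← ip_conj_symm hα (mem_e hα k) (mem_e hα j), main k j h, map_zero]
  · rw [if_pos h, h, ip_e_self hα]
  · rw [if_neg h.ne', main j k h]

theorem e_zero (α : ℝ) (z : ℂ) : e α 0 z = 1 := by simp [e]

/-- The reproducing property of the normalized kernel `T_w e_0`. -/
theorem ip_T_e_zero (hα : 0 < α) (hf : Mem α f) (w : ℂ) :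
    ip α f (T α w (e α 0)) = f w * ((Real.exp (-α / 2 * ‖w‖ ^ 2) : ℝ) : ℂ) := by
  rw [ip_T_right]
  have hm := hf.T (-w)
  have hint := integrable_mul_of_memLp_two (memLp_two_conj ((mem_e hα 0).memLp hα.le))
    (hm.memLp hα.le)
  have hpi := Real.pi_pos
  have hne : ((α / Real.pi : ℝ) : ℂ) ≠ 0 := by
    exact_mod_cast (div_pos hα hpi).ne'
  simp_rw [gaussMul_mul_conj hα.le] at hint
  have hint2 := hint.const_mul ((α / Real.pi : ℝ) : ℂ)⁻¹
  simp_rw [inv_mul_cancel_left₀ hne, e_zero, map_one, mul_one] at hint2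
  have h1 := integral_mul_radial (J := T α (-w) f)
    (η := fun r => ((Real.exp (-α * r ^ 2) : ℝ) : ℂ)) hm.1 (by fun_prop) hint2
  have h2 := integral_norm_pow_mul_exp hα 0
  simp only [mul_zero, pow_zero, one_mul, Nat.factorial_zero, Nat.cast_one, mul_one, zero_add,
    pow_one] at h2
  rw [ip]
  simp_rw [e_zero, map_one, mul_one]
  rw [h1, integral_complex_ofReal, h2]
  simp only [T, mul_zero, zero_sub, neg_neg, norm_neg]
  push_cast
  have : (Real.pi : ℂ) ≠ 0 := by exact_mod_cast hpi.ne'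
  have : (α : ℂ) ≠ 0 := by exact_mod_cast hα.ne'
  field_simp

theorem mem_T_e (hα : 0 < α) (w : ℂ) (k : ℕ) : Mem α (T α w (e α k)) := (mem_e hα k).T w

/-- The functions `T_w e_k` as elements of `L²`. -/
noncomputable def kernelL2 (hα : 0 < α) (w : ℂ) (k : ℕ) : Lp ℂ 2 (volume : Measure ℂ) :=
  toL2 hα ⟨_, mem_T_e hα w k⟩

theorem orthonormal_kernelL2 (hα : 0 < α) (w : ℂ) : Orthonormal ℂ (kernelL2 hα w) := by
  rw [orthonormal_iff_ite]
  intro i j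
  rw [kernelL2, kernelL2, inner_toL2, ip_T_T, ip_e_e hα]
  simp [eq_comm]

/-- By the reproducing property these are values of `T_w e_k` at z, and they form the Poisson
distribution of mean α|z-w|². -/
theorem norm_inner_kernelL2_sq (hα : 0 < α) (w z : ℂ) (k : ℕ) :
    ‖inner ℂ (kernelL2 hα w k) (kernelL2 hα z 0)‖ ^ 2 =
      Real.exp (-(α * ‖z - w‖ ^ 2)) * ((α * ‖z - w‖ ^ 2) ^ k / Nat.factorial k) := by
  rw [norm_inner_symm, kernelL2, kernelL2, inner_toL2]
  simp only
  rw [ip_T_e_zero hα (mem_T_e hα w k), norm_mul, mul_pow, ← norm_e_sq hα, Complex.norm_real,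
    Real.norm_eq_abs, sq_abs, ← Real.exp_nat_mul]
  have := norm_T_sq (α := α) w (e α k) z
  rw [show ((2 : ℕ) : ℝ) * (-α / 2 * ‖z‖ ^ 2) = -α * ‖z‖ ^ 2 by push_cast; ring, this, neg_mul,
    mul_comm]

end Fock

/-! ### Necessity -/

/-- Termwise comparison of the tails: x^m ≤ x^n for n ≥ m. This is the exponential Markov inequality
behind the Chernoff bound. -/
theorem exp_sub_sum_range_le {t x : ℝ} (ht : 0 ≤ t) (hx : 1 ≤ x) (m : ℕ) :
    x ^ m * (Real.exp t - ∑ k ∈ Finset.range m, t ^ k / k.factorial) ≤ Real.exp (x * t) := by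
  have hs : ∀ y : ℝ, HasSum (fun n : ℕ => y ^ n / n.factorial) (Real.exp y) := fun y => by
    rw [Real.exp_eq_exp_ℝ]; exact NormedSpace.expSeries_div_hasSum_exp y
  have h1 := (hasSum_nat_add_iff' m).2 (hs t)
  have h2 := (hasSum_nat_add_iff' m).2 (hs (x * t))
  have h3 := hasSum_le (fun k => ?_) (h1.mul_left (x ^ m)) h2
  · refine h3.trans (sub_le_self _ (Finset.sum_nonneg fun k _ => ?_))
    have : 0 ≤ x := by linarith
    positivity
  · rw [mul_pow, mul_div_assoc]
    have h4 : x ^ m ≤ x ^ (k + m) := pow_le_pow_right₀ hx (by omega)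
    gcongr

/-- A Chernoff bound for the Poisson distribution. -/
theorem one_sub_sum_poisson_le {t c : ℝ} {m : ℕ} (ht : 0 ≤ t) (hc : 0 ≤ c)
    (h : Real.sqrt t ≤ Real.sqrt m - c) :
    1 - ∑ k ∈ Finset.range m, Real.exp (-t) * (t ^ k / k.factorial) ≤ Real.exp (-c ^ 2) := by
  rcases ht.eq_or_lt with rfl | ht
  · rcases Nat.eq_zero_or_pos m with rfl | hm
    · have : c = 0 := by simp at h; linarith
      simp [this]
    · rw [Finset.sum_eq_single_of_mem 0 (by simpa using hm) (by
        intro k _ hk; simp [hk])]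
      simp [Real.exp_nonneg]
  set a := Real.sqrt t with ha
  set b := Real.sqrt m with hb
  have ha0 : 0 < a := Real.sqrt_pos.2 ht
  have hb0 : 0 < b := by linarith
  have ha2 : a ^ 2 = t := Real.sq_sqrt ht.le
  have hb2 : b ^ 2 = m := Real.sq_sqrt (by positivity)
  -- The parameter x = √(m/t) is not the optimal m/t. Together with log x ≥ 1 - 1/x it gives exactly
  -- exp(-(√m - √t)²).
  have hx : 1 ≤ b / a := (one_le_div ha0).2 (by linarith)
  have h1 := exp_sub_sum_range_le ht.le hx m
  have h2 : b / a * t = a * b := by rw [← ha2]; field_simp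
  have h3 : Real.exp (b ^ 2 - a * b) ≤ (b / a) ^ m := by
    rw [← Real.exp_log (show 0 < b / a by positivity), ← Real.exp_nat_mul, ← hb2]
    have := Real.one_sub_inv_le_log_of_pos (show 0 < b / a by positivity)
    refine Real.exp_le_exp.2 ?_
    have h4 : b ^ 2 - a * b = b ^ 2 * (1 - (b / a)⁻¹) := by field_simp
    rw [h4]
    gcongr
  set S := ∑ k ∈ Finset.range m, t ^ k / (k.factorial : ℝ) with hS
  have h5 : 0 ≤ Real.exp t - S := sub_nonneg.2 (Real.sum_le_exp_of_nonneg ht.le m)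
  have h6 : Real.exp (b ^ 2 - a * b) * (Real.exp t - S) ≤ Real.exp (a * b) := by
    exact ((mul_le_mul_of_nonneg_right h3 h5).trans h1).trans_eq (by rw [h2])
  have h7 : Real.exp t - S ≤ Real.exp (2 * (a * b) - b ^ 2) := by
    have : Real.exp (2 * (a * b) - b ^ 2) = Real.exp (a * b) / Real.exp (b ^ 2 - a * b) := by
      rw [← Real.exp_sub]; congr 1; ring
    rw [this, le_div_iff₀ (Real.exp_pos _), mul_comm]
    exact h6
  rw [← Finset.mul_sum, ← hS]
  calc 1 - Real.exp (-t) * S = Real.exp (-t) * (Real.exp t - S) := by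
        rw [mul_sub, ← Real.exp_add]; simp
    _ ≤ Real.exp (-t) * Real.exp (2 * (a * b) - b ^ 2) := by gcongr
    _ = Real.exp (-(b - a) ^ 2) := by rw [← Real.exp_add, ← ha2]; congr 1; ring
    _ ≤ Real.exp (-c ^ 2) := by
        refine Real.exp_le_exp.2 (neg_le_neg ?_)
        exact pow_le_pow_left₀ hc (by linarith) 2

/-! ### Lower Riesz bounds and orthogonal projections -/

section Riesz

variable {H : Type*} [NormedAddCommGroup H] [InnerProductSpace ℂ H]

/-- If every square summable moment problem for `φ` is solvable, then `φ` satisfies a lower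
Riesz bound. -/
theorem exists_lower_riesz_bound {I : Type*} (φ : I → H)
    (h : ∀ v : lp (fun _ : I => ℂ) 2, ∃ f : H, ∀ i, inner ℂ (φ i) f = v i) :
    ∃ M : ℝ, 0 ≤ M ∧ ∀ (s : Finset I) (c : I → ℂ),
      ∑ i ∈ s, ‖c i‖ ^ 2 ≤ M ^ 2 * ‖∑ i ∈ s, c i • φ i‖ ^ 2 := by
  classical
  -- Uniform boundedness is applied on ℓ² to the coefficient vectors of all finite combinations of
  -- norm at most 1. Their pairing with v is that of the combination with a solution f, hence at
  -- most ‖f‖.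
  let ι := {p : Finset I × (I → ℂ) // ‖∑ i ∈ p.1, p.2 i • φ i‖ ≤ 1}
  let x : Finset I × (I → ℂ) → lp (fun _ : I => ℂ) 2 := fun p => ∑ i ∈ p.1, lp.single 2 i (p.2 i)
  have hx : ∀ p, ‖x p‖ ^ 2 = ∑ i ∈ p.1, ‖p.2 i‖ ^ 2 := by
    intro p
    have := lp.norm_sum_single (p := 2) (E := fun _ : I => ℂ) (by norm_num) p.2 p.1
    simpa [x] using this
  have hin : ∀ (p : Finset I × (I → ℂ)) (v : lp (fun _ : I => ℂ) 2) (f : H),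
      (∀ i, inner ℂ (φ i) f = v i) → inner ℂ (x p) v = inner ℂ (∑ i ∈ p.1, p.2 i • φ i) f := by
    intro p v f hf
    simp only [x, sum_inner, inner_smul_left, hf, lp.inner_single_left]
    simp [mul_comm]
  obtain ⟨C, hC⟩ := banach_steinhaus (𝕜 := ℂ) (𝕜₂ := ℂ)
    (g := fun p : ι => innerSL ℂ (x p.1)) (by
      intro v
      obtain ⟨f, hf⟩ := h v
      refine ⟨‖f‖, fun p => ?_⟩
      rw [innerSL_apply_apply, hin p.1 v f hf]
      refine (norm_inner_le_norm _ _).trans ?_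
      exact (mul_le_mul_of_nonneg_right p.2 (norm_nonneg _)).trans (one_mul _).le)
  have hC0 : 0 ≤ C := (norm_nonneg _).trans (hC ⟨(∅, 0), by simp⟩)
  refine ⟨C, hC0, fun s c => ?_⟩
  set N := ‖∑ i ∈ s, c i • φ i‖ with hN
  -- N may be 0, so the combination is normalized by N + ε and ε then tends to 0.
  have key : ∀ ε : ℝ, 0 < ε → ∑ i ∈ s, ‖c i‖ ^ 2 ≤ C ^ 2 * (N + ε) ^ 2 := by
    intro ε hε
    have hpos : 0 < N + ε := by positivity
    have hle : ‖∑ i ∈ s, ((((N + ε)⁻¹ : ℝ) : ℂ) * c i) • φ i‖ ≤ 1 := by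
      simp_rw [mul_smul, ← Finset.smul_sum]
      rw [norm_smul, ← hN, Complex.norm_real, Real.norm_of_nonneg (by positivity),
        inv_mul_le_one₀ hpos]
      linarith
    have h1 := hC ⟨(s, fun i => (((N + ε)⁻¹ : ℝ) : ℂ) * c i), hle⟩
    simp only [innerSL_apply_norm] at h1
    have h2 := pow_le_pow_left₀ (norm_nonneg _) h1 2
    rw [hx] at h2
    simp only [norm_mul, mul_pow, ← Finset.mul_sum, Complex.norm_real, Real.norm_eq_abs, sq_abs,
      inv_pow] at h2
    rwa [inv_mul_le_iff₀ (by positivity), mul_comm] at h2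
  have hlim : Filter.Tendsto (fun ε : ℝ => C ^ 2 * (N + ε) ^ 2) (nhdsWithin 0 (Set.Ioi 0))
      (nhds (C ^ 2 * N ^ 2)) := by
    have : Continuous fun ε : ℝ => C ^ 2 * (N + ε) ^ 2 := by fun_prop
    simpa using (this.tendsto 0).mono_left nhdsWithin_le_nhds
  exact ge_of_tendsto hlim (eventually_mem_nhdsWithin.mono fun ε hε => key ε hε)

theorem norm_sub_sum_inner_smul_sq {v : ℕ → H} (hv : Orthonormal ℂ v) (x : H) (s : Finset ℕ) :
    ‖x - ∑ k ∈ s, inner ℂ (v k) x • v k‖ ^ 2 = ‖x‖ ^ 2 - ∑ k ∈ s, ‖inner ℂ (v k) x‖ ^ 2 := by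
  have h1 : inner ℂ x (∑ k ∈ s, inner ℂ (v k) x • v k) =
      ((∑ k ∈ s, ‖inner ℂ (v k) x‖ ^ 2 : ℝ) : ℂ) := by
    rw [inner_sum]
    push_cast
    refine Finset.sum_congr rfl fun k _ => ?_
    rw [inner_smul_right, ← inner_conj_symm x (v k), Complex.mul_conj']
  have h2 : ‖∑ k ∈ s, inner ℂ (v k) x • v k‖ ^ 2 = ∑ k ∈ s, ‖inner ℂ (v k) x‖ ^ 2 := by
    have h3 := hv.inner_sum (fun k => inner ℂ (v k) x) (fun k => inner ℂ (v k) x) s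
    rw [inner_self_eq_norm_sq_to_K] at h3
    simp_rw [Complex.conj_mul'] at h3
    apply Complex.ofReal_injective
    push_cast
    exact h3
  rw [@norm_sub_sq ℂ, h1, h2]
  simp only [RCLike.re_to_complex, Complex.ofReal_re]
  ring

end Riesz

namespace Fock

variable {α : ℝ}

theorem norm_kernelL2 (hα : 0 < α) (w : ℂ) (k : ℕ) : ‖kernelL2 hα w k‖ = 1 :=
  (orthonormal_kernelL2 hα w).1 k

/-- The squared distance is the Poisson tail beyond m, with mean α|z-w|². In the Chernoff bound, √m
- √(α|z-w|²) exceeds √α·C. -/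
theorem norm_kernelL2_sub_proj_sq_le (hα : 0 < α) {w z : ℂ} {m : ℕ} {C : ℝ} (hC : 0 ≤ C)
    (hz : z ∈ Metric.ball w (Real.sqrt (m / α) - C)) :
    ‖kernelL2 hα z 0 - ∑ k ∈ Finset.range m,
      inner ℂ (kernelL2 hα w k) (kernelL2 hα z 0) • kernelL2 hα w k‖ ^ 2 ≤
        Real.exp (-(α * C ^ 2)) := by
  rw [norm_sub_sum_inner_smul_sq (orthonormal_kernelL2 hα w), norm_kernelL2, one_pow]
  simp_rw [norm_inner_kernelL2_sq]
  rw [mem_ball_iff_norm] at hz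
  have h := one_sub_sum_poisson_le (t := α * ‖z - w‖ ^ 2) (c := Real.sqrt α * C) (m := m)
    (by positivity) (by positivity) (by
      rw [Real.sqrt_mul hα.le, Real.sqrt_sq (norm_nonneg _)]
      have h1 : Real.sqrt m = Real.sqrt α * Real.sqrt (m / α) := by
        rw [← Real.sqrt_mul hα.le]; congr 1; field_simp
      rw [h1, ← mul_sub]
      gcongr)
  rwa [mul_pow, Real.sq_sqrt hα.le] at h

theorem IsInterpolating.exists_lower_bound (hα : 0 < α) {Λ : Set ℂ} {m : Λ → ℕ}
    (h : IsInterpolating α Λ m) :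
    ∃ M : ℝ, 0 ≤ M ∧ ∀ (s : Finset (Σ l : Λ, Fin (m l))) (c : (Σ l : Λ, Fin (m l)) → ℂ),
      ∑ i ∈ s, ‖c i‖ ^ 2 ≤ M ^ 2 * ‖∑ i ∈ s, c i • kernelL2 hα (i.1 : ℂ) i.2‖ ^ 2 := by
  refine exists_lower_riesz_bound (fun i : (Σ l : Λ, Fin (m l)) => kernelL2 hα (i.1 : ℂ) i.2) ?_
  intro v
  have hv : Summable fun i => ‖v i‖ ^ 2 := by
    simpa using (lp.memℓp v).summable (by norm_num)
  obtain ⟨f, hf, hfv⟩ := h (fun l k => v ⟨l, k⟩) (by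
    have := ((summable_sigma_of_nonneg fun i => by positivity).1 hv).2
    simpa [tsum_fintype] using this)
  exact ⟨toL2 hα ⟨f, hf⟩, fun i => by rw [kernelL2, inner_toL2]; exact hfv i.1 i.2⟩

theorem IsInterpolating.exists_disjoint (hα : 0 < α) {Λ : Set ℂ} {m : Λ → ℕ}
    (h : IsInterpolating α Λ m) :
    ∃ C : ℝ, 0 < C ∧ Pairwise (fun l l' : Λ =>
      Disjoint (Metric.ball (l : ℂ) (Real.sqrt ((m l : ℝ) / α) - C))
        (Metric.ball (l' : ℂ) (Real.sqrt ((m l' : ℝ) / α) - C))) := by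
  classical
  obtain ⟨M, hM, hb⟩ := h.exists_lower_bound hα
  -- The final contradiction is 1 - δ ≤ 4M²δ with δ = exp(-αC²). It needs (4M² + 1)δ < 1, which
  -- follows from exp x > x at x = αC² = 4M² + 1.
  set C := Real.sqrt ((4 * M ^ 2 + 1) / α) with hC
  have hC0 : 0 < C := Real.sqrt_pos.2 (by positivity)
  have hC2 : α * C ^ 2 = 4 * M ^ 2 + 1 := by
    rw [hC, Real.sq_sqrt (by positivity)]; field_simp
  refine ⟨C, hC0, fun l l' hll => ?_⟩
  refine Set.disjoint_left.2 fun z hz hz' => ?_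
  set δ := Real.exp (-(α * C ^ 2)) with hδ
  have hδ1 : (4 * M ^ 2 + 1) * δ < 1 := by
    have h1 := Real.add_one_lt_exp (x := α * C ^ 2) (by rw [hC2]; positivity)
    rw [hδ, Real.exp_neg, ← hC2, mul_inv_lt_iff₀ (Real.exp_pos _)]
    linarith
  have e1 := norm_kernelL2_sub_proj_sq_le hα hC0.le hz
  have e2 := norm_kernelL2_sub_proj_sq_le hα hC0.le hz'
  set x := kernelL2 hα z 0 with hx
  set u := ∑ k ∈ Finset.range (m l),
      inner ℂ (kernelL2 hα l k) x • kernelL2 hα l k with hu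
  set u' := ∑ k ∈ Finset.range (m l'),
      inner ℂ (kernelL2 hα l' k) x • kernelL2 hα l' k with hu'
  have e3 : ‖u - u'‖ ^ 2 ≤ 4 * δ := by
    have h1 : u - u' = (x - u') - (x - u) := by abel
    have h2 := norm_sub_le (x - u') (x - u)
    rw [← h1] at h2
    have h3 := pow_le_pow_left₀ (norm_nonneg _) h2 2
    nlinarith [sq_nonneg (‖x - u'‖ - ‖x - u‖)]
  have e4 : 1 - δ ≤ ∑ k ∈ Finset.range (m l), ‖inner ℂ (kernelL2 hα l k) x‖ ^ 2 := by
    have h1 := norm_sub_sum_inner_smul_sq (orthonormal_kernelL2 hα (l : ℂ)) x (Finset.range (m l))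
    rw [← hu, hx, norm_kernelL2, one_pow, ← hx] at h1
    linarith
  -- These coefficients, summed over l and l', give u - u'.
  let c : (Σ l : Λ, Fin (m l)) → ℂ := fun i =>
    (if i.1 = l then 1 else -1) * inner ℂ (kernelL2 hα i.1 i.2) x
  have e5 := hb (({l, l'} : Finset Λ).sigma fun _ => Finset.univ) c
  rw [Finset.sum_sigma, Finset.sum_sigma, Finset.sum_pair hll, Finset.sum_pair hll] at e5
  simp only [c, if_true, if_neg hll.symm, one_mul, neg_mul, norm_neg, neg_smul,
    Finset.sum_neg_distrib, ← sub_eq_add_neg] at e5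
  rw [Fin.sum_univ_eq_sum_range (fun k => ‖inner ℂ (kernelL2 hα l k) x‖ ^ 2),
    Fin.sum_univ_eq_sum_range (fun k => ‖inner ℂ (kernelL2 hα l' k) x‖ ^ 2),
    Fin.sum_univ_eq_sum_range (fun k => inner ℂ (kernelL2 hα l k) x • kernelL2 hα l k),
    Fin.sum_univ_eq_sum_range (fun k => inner ℂ (kernelL2 hα l' k) x • kernelL2 hα l' k),
    ← hu, ← hu'] at e5
  have e6 : 0 ≤ ∑ k ∈ Finset.range (m l'), ‖inner ℂ (kernelL2 hα l' k) x‖ ^ 2 :=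
    Finset.sum_nonneg fun k _ => by positivity
  have e7 : M ^ 2 * ‖u - u'‖ ^ 2 ≤ M ^ 2 * (4 * δ) := by gcongr
  nlinarith

end Fock

/-! ### The weight -/

section RadialWeight

/-- The `C¹` function vanishing for `t ≤ a`, equal to `t - (a + b) / 2` for `t ≥ b`, and quadratic
in between. -/
noncomputable def softRamp (a b t : ℝ) : ℝ := ((max 0 (t - a)) ^ 2 - (max 0 (t - b)) ^ 2) / (2 * (b - a))

/-- The derivative of `softRamp`. -/
noncomputable def softStep (a b t : ℝ) : ℝ := (max 0 (t - a) - max 0 (t - b)) / (b - a)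

variable {a b t α : ℝ}

theorem hasDerivAt_max_zero_sq (x : ℝ) : HasDerivAt (fun y : ℝ => (max 0 y) ^ 2) (2 * max 0 x) x := by
  rcases lt_trichotomy x 0 with h | h | h
  · rw [max_eq_left h.le, mul_zero]
    refine (hasDerivAt_const x (0 : ℝ)).congr_of_eventuallyEq ?_
    filter_upwards [gt_mem_nhds h] with y hy
    rw [max_eq_left hy.le]; simp
  · subst h
    rw [hasDerivAt_iff_isLittleO_nhds_zero]
    simp only [max_self, zero_add, mul_zero, smul_zero, sub_zero, ne_eq, OfNat.ofNat_ne_zero,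
      not_false_eq_true, zero_pow]
    refine Asymptotics.IsBigO.trans_isLittleO (g := fun y : ℝ => y ^ 2) ?_ ?_
    · refine Asymptotics.IsBigO.of_bound 1 (Filter.Eventually.of_forall fun y => ?_)
      rw [one_mul, norm_pow, norm_pow, Real.norm_eq_abs, Real.norm_eq_abs]
      refine pow_le_pow_left₀ (abs_nonneg _) ?_ 2
      rw [abs_of_nonneg (le_max_left _ _)]
      exact max_le (abs_nonneg _) (le_abs_self _)
    · simpa using Asymptotics.isLittleO_pow_id (𝕜 := ℝ) one_lt_two
  · rw [max_eq_right h.le]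
    have := (hasDerivAt_pow 2 x)
    refine HasDerivAt.congr_of_eventuallyEq (f := fun y => y ^ 2) (by simpa using this) ?_
    filter_upwards [lt_mem_nhds h] with y hy
    rw [max_eq_right hy.le]

theorem hasDerivAt_softRamp (hab : a < b) (t : ℝ) :
    HasDerivAt (softRamp a b) (softStep a b t) t := by
  have h1 := (hasDerivAt_max_zero_sq (t - a)).comp t ((hasDerivAt_id t).sub_const a)
  have h2 := (hasDerivAt_max_zero_sq (t - b)).comp t ((hasDerivAt_id t).sub_const b)
  have h3 := (h1.sub h2).div_const (2 * (b - a))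
  refine HasDerivAt.congr_deriv (f := softRamp a b) h3 ?_
  have : b - a ≠ 0 := (sub_pos.2 hab).ne'
  rw [softStep]
  field_simp

theorem continuous_softStep : Continuous (softStep a b) := by
  unfold softStep; fun_prop

theorem softStep_nonneg (hab : a < b) : 0 ≤ softStep a b t :=
  div_nonneg (sub_nonneg.2 (max_le_max le_rfl (by linarith))) (sub_nonneg.2 hab.le)

theorem softStep_of_le (hab : a < b) (h : t ≤ a) : softStep a b t = 0 := by
  rw [softStep, max_eq_left (by linarith), max_eq_left (by linarith)]; simp

theorem softStep_of_ge (hab : a < b) (h : b ≤ t) : softStep a b t = 1 := by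
  rw [softStep, max_eq_right (by linarith), max_eq_right (by linarith),
    div_eq_one_iff_eq (sub_pos.2 hab).ne']
  ring

theorem softRamp_of_le (hab : a < b) (h : t ≤ a) : softRamp a b t = 0 := by
  rw [softRamp, max_eq_left (by linarith), max_eq_left (by linarith)]; simp

theorem softRamp_of_ge (hab : a < b) (h : b ≤ t) : softRamp a b t = t - (a + b) / 2 := by
  have : b - a ≠ 0 := (sub_pos.2 hab).ne'
  rw [softRamp, max_eq_right (by linarith), max_eq_right (by linarith)]
  field_simp
  ring

/-- The ramp is convex and lies above its asymptote. On [a, b] the difference is (t - b)² / (2(b -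
a)). -/
theorem sub_le_softRamp (hab : a < b) : t - (a + b) / 2 ≤ softRamp a b t := by
  rcases le_total t a with h | h
  · rw [softRamp_of_le hab h]; linarith
  rcases le_total b t with h' | h'
  · rw [softRamp_of_ge hab h']
  · have : 0 < b - a := sub_pos.2 hab
    rw [softRamp, max_eq_right (by linarith), max_eq_left (by linarith), le_div_iff₀ (by linarith)]
    nlinarith [sq_nonneg (t - b)]

/-- The derivative of the radial potential, as a function of the squared radius. -/
noncomputable def potDeriv (α a b t : ℝ) : ℝ := α * (softRamp a b t / t - 1)

/-- The derivative of `potDeriv`. -/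
noncomputable def potDeriv2 (α a b t : ℝ) : ℝ :=
  α * ((softStep a b t * t - softRamp a b t) / t ^ 2)

/-- The ramp vanishes up to a > 0, so the quotient by t is identically 0 near the origin, also at t
= 0 under the division convention. -/
theorem hasDerivAt_potDeriv (ha : 0 < a) (hab : a < b) (t : ℝ) :
    HasDerivAt (potDeriv α a b) (potDeriv2 α a b t) t := by
  have key : HasDerivAt (fun t => softRamp a b t / t)
      ((softStep a b t * t - softRamp a b t) / t ^ 2) t := by
    rcases lt_or_ge t a with h | h
    · rw [softStep_of_le hab h.le, softRamp_of_le hab h.le]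
      simp only [zero_mul, sub_zero, zero_div]
      refine (hasDerivAt_const t (0 : ℝ)).congr_of_eventuallyEq ?_
      filter_upwards [gt_mem_nhds h] with y hy
      rw [softRamp_of_le hab hy.le]; simp
    · have h1 := (hasDerivAt_softRamp hab t).div (hasDerivAt_id t) (by simp; linarith)
      exact HasDerivAt.congr_deriv (f := fun t => softRamp a b t / t) h1 (by simp)
  exact (key.sub_const 1).const_mul α

theorem continuous_potDeriv (ha : 0 < a) (hab : a < b) : Continuous (potDeriv α a b) :=
  continuous_iff_continuousAt.2 fun t => (hasDerivAt_potDeriv ha hab t).continuousAt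

theorem continuous_potDeriv2 (ha : 0 < a) (hab : a < b) : Continuous (potDeriv2 α a b) := by
  have hs : Continuous (softRamp a b) :=
    continuous_iff_continuousAt.2 fun t => (hasDerivAt_softRamp hab t).continuousAt
  have hs2 : Continuous (softStep a b) := continuous_softStep
  refine continuous_iff_continuousAt.2 fun t => ?_
  rcases lt_or_ge t a with h | h
  · refine (continuousAt_const (y := (0 : ℝ))).congr ?_
    filter_upwards [gt_mem_nhds h] with y hy
    rw [potDeriv2, softStep_of_le hab hy.le, softRamp_of_le hab hy.le]
    simp
  · have ht : t ≠ 0 := by linarith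
    unfold potDeriv2
    exact continuousAt_const.mul (ContinuousAt.div (by fun_prop) (by fun_prop) (by positivity))

/-- For a radial function ψ(|z|²), ∂∂̄ is tψ'' + ψ' at t = |z|². Thus the potential cancels the
density α for t ≤ a and changes nothing for t ≥ b. -/
theorem mul_potDeriv2_add (ha : 0 < a) (hab : a < b) (t : ℝ) :
    potDeriv2 α a b t * t + potDeriv α a b t = α * (softStep a b t - 1) := by
  rcases eq_or_ne t 0 with rfl | ht
  · rw [softStep_of_le hab ha.le]; simp [potDeriv]
  · rw [potDeriv, potDeriv2]
    field_simp
    ring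

/-- The radial potential, as a function of the squared radius. -/
noncomputable def pot (α a b t : ℝ) : ℝ :=
  -(α * ((a + b) / 2) * Real.log b) + ∫ s in b..t, potDeriv α a b s

theorem hasDerivAt_pot (ha : 0 < a) (hab : a < b) (t : ℝ) :
    HasDerivAt (pot α a b) (potDeriv α a b t) t := by
  have hc := continuous_potDeriv (α := α) ha hab
  exact (intervalIntegral.integral_hasDerivAt_right (hc.intervalIntegrable _ _)
    hc.aestronglyMeasurable.stronglyMeasurableAtFilter hc.continuousAt).const_add _

theorem pot_of_ge (ha : 0 < a) (hab : a < b) (h : b ≤ t) :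
    pot α a b t = -(α * ((a + b) / 2) * Real.log t) := by
  have h1 : ∫ s in b..t, potDeriv α a b s = ∫ s in b..t, -(α * ((a + b) / 2)) * s⁻¹ := by
    refine intervalIntegral.integral_congr fun s hs => ?_
    rw [Set.uIcc_of_le h] at hs
    have : s ≠ 0 := by linarith [hs.1]
    simp only [potDeriv, softRamp_of_ge hab hs.1]
    field_simp
    ring
  have hb : 0 < b := ha.trans hab
  rw [pot, h1, intervalIntegral.integral_const_mul, integral_inv_of_pos hb (by linarith),
    Real.log_div (by linarith) (by linarith)]
  ring

/-- The left side is nondecreasing in t, because the ramp lies above its asymptote, and it is 0 at t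
= b. -/
theorem pot_add_log_nonpos (hα : 0 < α) (ha : 0 < a) (hab : a < b) (ht : 0 < t) :
    pot α a b t + α * ((a + b) / 2) * Real.log t ≤ 0 := by
  rcases le_total b t with h | h
  · rw [pot_of_ge ha hab h]; linarith
  have hd : ∀ s ∈ Set.Ioi (0 : ℝ), HasDerivAt
      (fun s => pot α a b s + α * ((a + b) / 2) * Real.log s)
      (potDeriv α a b s + α * ((a + b) / 2) * s⁻¹) s := fun s hs =>
    (hasDerivAt_pot ha hab s).add ((Real.hasDerivAt_log (ne_of_gt hs)).const_mul _)
  have hmono : MonotoneOn (fun s => pot α a b s + α * ((a + b) / 2) * Real.log s)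
      (Set.Ioi 0) := by
    refine monotoneOn_of_deriv_nonneg (convex_Ioi 0)
      (fun s hs => (hd s hs).continuousAt.continuousWithinAt) ?_ ?_
    · rw [interior_Ioi]
      exact fun s hs => (hd s hs).differentiableAt.differentiableWithinAt
    · rw [interior_Ioi]
      intro s hs
      rw [(hd s hs).deriv]
      have hs0 : (0 : ℝ) < s := hs
      have h1 := sub_le_softRamp (t := s) hab
      have h2 : potDeriv α a b s + α * ((a + b) / 2) * s⁻¹ =
          α * (softRamp a b s - (s - (a + b) / 2)) / s := by
        rw [potDeriv]; field_simp; ring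
      rw [h2]
      exact div_nonneg (mul_nonneg hα.le (by linarith)) hs0.le
  have h3 := hmono (show t ∈ Set.Ioi 0 from ht) (show b ∈ Set.Ioi 0 from ha.trans hab) h
  simp only [pot_of_ge ha hab le_rfl] at h3
  linarith

end RadialWeight

/-! ### The plane weight built from the radial potentials -/

section Weight

open ComplexConjugate

variable (α : ℝ) (S : Finset ℂ) (a b : ℂ → ℝ)

/-- The exponential of the potential `α|z|²` corrected inside the discs `|z - l|² < b l`. -/
noncomputable def weight (z : ℂ) : ℝ :=
  Real.exp (α * ‖z‖ ^ 2 + ∑ l ∈ S, pot α (a l) (b l) (‖z - l‖ ^ 2))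

/-- The logarithmic `∂`-derivative of `weight`. -/
noncomputable def weightDz (z : ℂ) : ℂ :=
  α * conj z + ∑ l ∈ S, ((potDeriv α (a l) (b l) (‖z - l‖ ^ 2) : ℝ) : ℂ) * conj (z - l)

/-- The complex Laplacian of the logarithm of `weight`. -/
noncomputable def weightLap (z : ℂ) : ℝ :=
  α + ∑ l ∈ S, α * (softStep (a l) (b l) (‖z - l‖ ^ 2) - 1)

variable {α S a b}

theorem weight_pos (z : ℂ) : 0 < weight α S a b z := Real.exp_pos _

theorem hasWirtinger_weight (ha : ∀ l ∈ S, 0 < a l) (hab : ∀ l ∈ S, a l < b l) (z : ℂ) :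
    HasWirtinger (fun w => (weight α S a b w : ℂ))
      (weightDz α S a b z * weight α S a b z) (conj (weightDz α S a b z) * weight α S a b z) z := by
  have h0 : HasWirtinger (fun w => ((‖w‖ ^ 2 : ℝ) : ℂ)) (conj z) z z := by
    simpa using HasWirtinger.normSq_sub (z := z) 0
  have h1 := (HasWirtinger.const (z := z) (α : ℂ)).mul h0
  have h2 := HasWirtinger.sum (s := S) fun l hl =>
    (HasWirtinger.normSq_sub (z := z) l).ofReal_comp
      (hasDerivAt_pot (α := α) (ha l hl) (hab l hl) (‖z - l‖ ^ 2))
  have h3 := h1.add h2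
  have h4 : HasWirtinger (fun w => ((α * ‖w‖ ^ 2 +
      ∑ l ∈ S, pot α (a l) (b l) (‖w - l‖ ^ 2) : ℝ) : ℂ)) (weightDz α S a b z)
      (conj (weightDz α S a b z)) z := by
    convert! h3 using 1
    · ext w; push_cast; rfl
    · simp [weightDz]
    · simp [weightDz]
  refine (h4.ofReal_comp (Real.hasDerivAt_exp _)).congr ?_ ?_ <;> rw [weight] <;> ring

theorem hasWirtinger_weightDz (ha : ∀ l ∈ S, 0 < a l) (hab : ∀ l ∈ S, a l < b l) (z : ℂ) :
    HasWirtinger (weightDz α S a b)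
      (∑ l ∈ S, ((potDeriv2 α (a l) (b l) (‖z - l‖ ^ 2) : ℝ) : ℂ) * conj (z - l) * conj (z - l))
      (weightLap α S a b z) z := by
  have h1 := (HasWirtinger.const (z := z) (α : ℂ)).mul (HasWirtinger.id (z := z)).conj_comp
  have h2 := HasWirtinger.sum (s := S) fun l hl =>
    ((HasWirtinger.normSq_sub (z := z) l).ofReal_comp
      (hasDerivAt_potDeriv (α := α) (ha l hl) (hab l hl) (‖z - l‖ ^ 2))).mul
      ((HasWirtinger.id (z := z)).sub (HasWirtinger.const l)).conj_comp
  refine (h1.add h2).congr ?_ ?_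
  · simp
  · rw [weightLap]
    push_cast
    simp only [zero_mul, map_one, sub_zero, mul_one, zero_add]
    congr 1
    refine Finset.sum_congr rfl fun l hl => ?_
    have h3 := mul_potDeriv2_add (α := α) (ha l hl) (hab l hl) (‖z - l‖ ^ 2)
    have h4 := congrArg (fun x : ℝ => (x : ℂ)) h3
    simp only [Complex.ofReal_add, Complex.ofReal_mul, Complex.ofReal_pow, Complex.ofReal_sub,
      Complex.ofReal_one, ← Complex.mul_conj'] at h4
    rw [← h4]
    ring

theorem contDiff_weightDz (ha : ∀ l ∈ S, 0 < a l) (hab : ∀ l ∈ S, a l < b l) :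
    ContDiff ℝ 1 (weightDz α S a b) := by
  refine contDiff_one_of_hasWirtinger (fun z => hasWirtinger_weightDz ha hab z) ?_ ?_
  · refine continuous_finsetSum _ fun l hl => ?_
    have := continuous_potDeriv2 (α := α) (ha l hl) (hab l hl)
    fun_prop
  · unfold weightLap
    refine Complex.continuous_ofReal.comp (continuous_const.add
      (continuous_finsetSum _ fun l hl => ?_))
    have := continuous_softStep (a := a l) (b := b l)
    fun_prop

theorem dbar_weightDz (ha : ∀ l ∈ S, 0 < a l) (hab : ∀ l ∈ S, a l < b l) (z : ℂ) :
    dbar (weightDz α S a b) z = weightLap α S a b z :=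
  (hasWirtinger_weightDz ha hab z).dbar_eq

theorem weightLap_of_ge (hab : ∀ l ∈ S, a l < b l) {z : ℂ}
    (hz : ∀ l ∈ S, b l ≤ ‖z - l‖ ^ 2) : weightLap α S a b z = α := by
  rw [weightLap, Finset.sum_eq_zero, add_zero]
  intro l hl
  rw [softStep_of_ge (hab l hl) (hz l hl)]
  ring

/-- By disjointness at most one correction is active at z, and a single one lowers α to no less than
0. -/
theorem weightLap_nonneg (hα : 0 < α) (hab : ∀ l ∈ S, a l < b l)
    (hdis : ∀ l ∈ S, ∀ l' ∈ S, ∀ z, ‖z - l‖ ^ 2 < b l → ‖z - l'‖ ^ 2 < b l' → l = l') (z : ℂ) :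
    0 ≤ weightLap α S a b z := by
  by_cases h : ∀ l ∈ S, b l ≤ ‖z - l‖ ^ 2
  · rw [weightLap_of_ge hab h]; exact hα.le
  push Not at h
  obtain ⟨l, hl, hz⟩ := h
  rw [weightLap, Finset.sum_eq_single_of_mem l hl]
  · nlinarith [softStep_nonneg (t := ‖z - l‖ ^ 2) (hab l hl)]
  · intro l' hl' hne
    rw [softStep_of_ge (hab l' hl')]
    · ring
    · by_contra! hlt
      exact hne (hdis l' hl' l hl z hlt hz)

variable {m : ℂ → ℕ}

theorem norm_pow_mul_exp_pot_le (hα : 0 < α) {a b : ℝ} {m : ℕ} (ha : 0 < a) (hab : a < b)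
    (hm : (m : ℝ) = α * ((a + b) / 2)) {t : ℝ} (ht : 0 ≤ t) :
    t ^ m * Real.exp (pot α a b t) ≤ 1 := by
  rcases ht.eq_or_lt with rfl | ht
  · have : m ≠ 0 := by
      rintro rfl
      have : 0 < α * ((a + b) / 2) := by have := ha.trans hab; positivity
      simp at hm
      rcases hm with h | h <;> linarith
    simp [this]
  · have h := pot_add_log_nonpos hα ha hab ht
    rw [← Real.exp_log (pow_pos ht m), ← Real.exp_add, Real.log_pow, hm, Real.exp_le_one_iff]
    linarith

theorem norm_pow_mul_exp_pot_eq {a b : ℝ} {m : ℕ} (ha : 0 < a) (hab : a < b)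
    (hm : (m : ℝ) = α * ((a + b) / 2)) {t : ℝ} (ht : b ≤ t) :
    t ^ m * Real.exp (pot α a b t) = 1 := by
  have ht0 : 0 < t := by linarith
  rw [pot_of_ge ha hab ht, ← hm, ← Real.log_pow, Real.exp_neg, Real.exp_log (by positivity)]
  exact mul_inv_cancel₀ (by positivity)

theorem norm_prod_sq_mul_weight (z : ℂ) :
    ‖∏ l ∈ S, (z - l) ^ m l‖ ^ 2 * weight α S a b z = Real.exp (α * ‖z‖ ^ 2) *
      ∏ l ∈ S, ((‖z - l‖ ^ 2) ^ m l * Real.exp (pot α (a l) (b l) (‖z - l‖ ^ 2))) := by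
  rw [weight, Real.exp_add, Real.exp_sum, Finset.prod_mul_distrib, norm_prod, ← Finset.prod_pow]
  have : ∀ l ∈ S, ‖(z - l) ^ m l‖ ^ 2 = (‖z - l‖ ^ 2) ^ m l := fun l _ => by
    rw [norm_pow]; ring
  rw [Finset.prod_congr rfl this]
  ring

theorem norm_prod_sq_mul_weight_le (hα : 0 < α) (ha : ∀ l ∈ S, 0 < a l) (hab : ∀ l ∈ S, a l < b l)
    (hm : ∀ l ∈ S, (m l : ℝ) = α * ((a l + b l) / 2)) (z : ℂ) :
    ‖∏ l ∈ S, (z - l) ^ m l‖ ^ 2 * weight α S a b z ≤ Real.exp (α * ‖z‖ ^ 2) := by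
  rw [norm_prod_sq_mul_weight]
  refine mul_le_of_le_one_right (Real.exp_nonneg _) (Finset.prod_le_one ?_ ?_)
  · intro l _; positivity
  · exact fun l hl => norm_pow_mul_exp_pot_le hα (ha l hl) (hab l hl) (hm l hl) (by positivity)

theorem norm_prod_sq_mul_weight_eq (ha : ∀ l ∈ S, 0 < a l) (hab : ∀ l ∈ S, a l < b l)
    (hm : ∀ l ∈ S, (m l : ℝ) = α * ((a l + b l) / 2)) {z : ℂ}
    (hz : ∀ l ∈ S, b l ≤ ‖z - l‖ ^ 2) :
    ‖∏ l ∈ S, (z - l) ^ m l‖ ^ 2 * weight α S a b z = Real.exp (α * ‖z‖ ^ 2) := by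
  rw [norm_prod_sq_mul_weight, Finset.prod_eq_one, mul_one]
  exact fun l hl => norm_pow_mul_exp_pot_eq (ha l hl) (hab l hl) (hm l hl) (hz l hl)

theorem continuous_weight (ha : ∀ l ∈ S, 0 < a l) (hab : ∀ l ∈ S, a l < b l) :
    Continuous (weight α S a b) := by
  have h : Continuous fun w => (weight α S a b w : ℂ) :=
    continuous_iff_continuousAt.2 fun z =>
      (hasWirtinger_weight (α := α) ha hab z).differentiableAt.continuousAt
  simpa only [Function.comp_def, Complex.ofReal_re] using Complex.continuous_re.comp h

end Weight

/-! ### Cutoff functions -/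

section Cutoff

/-- A global minimum is attained at x, which also settles the endpoint x = 0. -/
theorem deriv_smoothTransition_of_nonpos {x : ℝ} (hx : x ≤ 0) :
    deriv Real.smoothTransition x = 0 := by
  refine IsLocalMin.deriv_eq_zero (Filter.Eventually.of_forall fun y => ?_)
  rw [Real.smoothTransition.zero_of_nonpos hx]
  exact Real.smoothTransition.nonneg y

theorem deriv_smoothTransition_of_one_le {x : ℝ} (hx : 1 ≤ x) :
    deriv Real.smoothTransition x = 0 := by
  refine IsLocalMax.deriv_eq_zero (Filter.Eventually.of_forall fun y => ?_)
  rw [Real.smoothTransition.one_of_one_le hx]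
  exact Real.smoothTransition.le_one y

theorem continuous_deriv_smoothTransition : Continuous (deriv Real.smoothTransition) :=
  (Real.smoothTransition.contDiff (n := 1)).continuous_deriv le_rfl

theorem exists_abs_deriv_smoothTransition_le :
    ∃ K : ℝ, 0 ≤ K ∧ ∀ x, |deriv Real.smoothTransition x| ≤ K := by
  obtain ⟨K, hK⟩ := (isCompact_Icc (a := (0 : ℝ)) (b := 1)).exists_bound_of_continuousOn
    continuous_deriv_smoothTransition.continuousOn
  have hK0 : 0 ≤ K := (norm_nonneg _).trans (hK 0 (by simp))
  refine ⟨K, hK0, fun x => ?_⟩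
  rcases le_total x 0 with h | h
  · rw [deriv_smoothTransition_of_nonpos h]; simpa
  rcases le_total 1 x with h' | h'
  · rw [deriv_smoothTransition_of_one_le h']; simpa
  · exact hK x ⟨h, h'⟩

/-- A smooth cutoff equal to `1` for `|z - l|² ≤ b` and to `0` for `|z - l|² ≥ d`. -/
noncomputable def cutoff (b d : ℝ) (l z : ℂ) : ℝ :=
  Real.smoothTransition ((d - ‖z - l‖ ^ 2) / (d - b))

/-- The `∂̄`-derivative of `cutoff`. -/
noncomputable def cutoffDbar (b d : ℝ) (l z : ℂ) : ℂ :=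
  ((deriv Real.smoothTransition ((d - ‖z - l‖ ^ 2) / (d - b)) * (-1 / (d - b)) : ℝ) : ℂ) * (z - l)

variable {b d : ℝ} {l z : ℂ}

theorem hasWirtinger_cutoff : HasWirtinger (fun w => (cutoff b d l w : ℂ))
    (dz (fun w => (cutoff b d l w : ℂ)) z) (cutoffDbar b d l z) z := by
  have h1 : HasDerivAt (fun t : ℝ => Real.smoothTransition ((d - t) / (d - b)))
      (deriv Real.smoothTransition ((d - ‖z - l‖ ^ 2) / (d - b)) * (-1 / (d - b)))
      (‖z - l‖ ^ 2) := by
    have h2 : HasDerivAt (fun t : ℝ => (d - t) / (d - b)) (-1 / (d - b)) (‖z - l‖ ^ 2) :=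
      ((hasDerivAt_id _).const_sub d).div_const _
    exact ((Real.smoothTransition.contDiff (n := 1)).differentiable one_ne_zero
      _).hasDerivAt.comp _ h2
  have h3 := (HasWirtinger.normSq_sub (z := z) l).ofReal_comp h1
  have h4 : HasWirtinger (fun w => (cutoff b d l w : ℂ)) _ (cutoffDbar b d l z) z := h3
  exact h4.congr h4.dz_eq.symm rfl

theorem contDiff_cutoff : ContDiff ℝ 1 (fun w => (cutoff b d l w : ℂ)) := by
  refine Complex.ofRealCLM.contDiff.comp (Real.smoothTransition.contDiff.comp ?_)
  exact (contDiff_const.sub ((contDiff_id.sub contDiff_const).norm_sq ℝ)).div_const _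

theorem cutoff_of_le (hbd : b < d) (h : ‖z - l‖ ^ 2 ≤ b) : cutoff b d l z = 1 :=
  Real.smoothTransition.one_of_one_le ((one_le_div (by linarith)).2 (by linarith))

theorem cutoff_of_ge (hbd : b < d) (h : d ≤ ‖z - l‖ ^ 2) : cutoff b d l z = 0 :=
  Real.smoothTransition.zero_of_nonpos
    (div_nonpos_of_nonpos_of_nonneg (by linarith) (by linarith))

theorem norm_cutoff_le_one : ‖(cutoff b d l z : ℂ)‖ ≤ 1 := by
  rw [Complex.norm_real, cutoff, Real.norm_of_nonneg (Real.smoothTransition.nonneg _)]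
  exact Real.smoothTransition.le_one _

theorem cutoffDbar_of_le (hbd : b < d) (h : ‖z - l‖ ^ 2 ≤ b) : cutoffDbar b d l z = 0 := by
  rw [cutoffDbar, deriv_smoothTransition_of_one_le ((one_le_div (by linarith)).2 (by linarith))]
  simp

theorem cutoffDbar_of_ge (hbd : b < d) (h : d ≤ ‖z - l‖ ^ 2) : cutoffDbar b d l z = 0 := by
  rw [cutoffDbar, deriv_smoothTransition_of_nonpos
    (div_nonpos_of_nonpos_of_nonneg (by linarith) (by linarith))]
  simp

theorem norm_cutoffDbar_le (hbd : b < d) {K : ℝ}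
    (hK : ∀ x, |deriv Real.smoothTransition x| ≤ K) :
    ‖cutoffDbar b d l z‖ ≤ K * (Real.sqrt d / (d - b)) := by
  have hK0 : 0 ≤ K := (abs_nonneg _).trans (hK 0)
  have hpos : 0 < d - b := sub_pos.2 hbd
  rcases le_total d (‖z - l‖ ^ 2) with h | h
  · rw [cutoffDbar_of_ge hbd h, norm_zero]; positivity
  · have h1 : ‖z - l‖ ≤ Real.sqrt d := Real.le_sqrt_of_sq_le h
    rw [cutoffDbar, norm_mul, Complex.norm_real, norm_mul, Real.norm_eq_abs, Real.norm_eq_abs,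
      abs_div, abs_neg, abs_one, abs_of_pos hpos, mul_assoc, one_div_mul_eq_div]
    have := hK ((d - ‖z - l‖ ^ 2) / (d - b))
    gcongr

end Cutoff

/-! ### Order of vanishing from integrability -/

/-- Polar coordinates reduce this to the divergence of ∫ dy/y at 0. -/
theorem not_integrableOn_ball_inv_norm_sq {l : ℂ} {r : ℝ} (hr : 0 < r) :
    ¬ IntegrableOn (fun z : ℂ => (‖z - l‖ ^ 2)⁻¹) (Metric.ball l r) := by
  intro h
  have h1 : IntegrableOn (fun z : ℂ => (‖z‖ ^ 2)⁻¹) (Metric.ball 0 r) := by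
    have h2 := (measurePreserving_add_right (volume : Measure ℂ) l).integrableOn_comp_preimage
      (measurableEmbedding_addRight l) (f := fun z : ℂ => (‖z - l‖ ^ 2)⁻¹) (s := Metric.ball l r)
    have h3 := h2.2 h
    have h4 : (fun x => x + l) ⁻¹' Metric.ball l r = Metric.ball 0 r := by
      ext x; simp
    rw [h4] at h3
    simpa [Function.comp_def] using h3
  have h2 := (integrableOn_fun_norm_addHaar (volume : Measure ℂ)
    (f := fun y : ℝ => (y ^ 2)⁻¹) (r := r)).1 h1
  have h3 : IntegrableOn (fun y : ℝ => y⁻¹) (Set.Ioo 0 r) := by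
    refine h2.congr_fun (fun y hy => ?_) measurableSet_Ioo
    have := hy.1.ne'
    simp only [Complex.finrank_real_complex, Nat.add_one_sub_one, pow_one, smul_eq_mul]
    field_simp
  rw [← integrableOn_Ioc_iff_integrableOn_Ioo, ← intervalIntegrable_iff_integrableOn_Ioc_of_le hr.le,
    intervalIntegrable_inv_iff] at h3
  rcases h3 with h3 | h3
  · exact hr.ne h3
  · exact h3 (by simp [hr.le])

/-- If K vanished only to order n < m at l, the integrand would dominate a multiple of |z-l|⁻² near
l. Factors z - l are therefore split off one at a time. -/
theorem exists_eq_pow_mul_of_integrableOn {K : ℂ → ℂ} (hK : Differentiable ℂ K) {l : ℂ} {r : ℝ}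
    (hr : 0 < r) (m : ℕ)
    (hi : IntegrableOn (fun z => ‖K z‖ ^ 2 / ‖z - l‖ ^ (2 * m)) (Metric.ball l r)) :
    ∃ L : ℂ → ℂ, Differentiable ℂ L ∧ ∀ z, K z = (z - l) ^ m * L z := by
  suffices ∀ n ≤ m, ∃ L : ℂ → ℂ, Differentiable ℂ L ∧ ∀ z, K z = (z - l) ^ n * L z from
    this m le_rfl
  intro n
  induction n with
  | zero => exact fun _ => ⟨K, hK, fun z => by simp⟩
  | succ n ih =>
    intro hn
    obtain ⟨L, hL, hKL⟩ := ih (by omega)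
    have hL0 : L l = 0 := by
      by_contra hne
      have hc : 0 < ‖L l‖ / 2 := by positivity
      obtain ⟨ρ, hρ, hρL⟩ := Metric.eventually_nhds_iff_ball.1
        ((hL.continuous.norm.continuousAt (x := l)).eventually
          (lt_mem_nhds (show ‖L l‖ / 2 < ‖L l‖ by linarith)))
      refine not_integrableOn_ball_inv_norm_sq (l := l)
        (show 0 < min ρ (min r 1) by positivity) ?_
      have hi2 := (hi.mono_set (Metric.ball_subset_ball
        (show min ρ (min r 1) ≤ r from (min_le_right _ _).trans (min_le_left _ _)))).const_mul
        ((‖L l‖ / 2) ^ 2)⁻¹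
      refine Integrable.mono' hi2 (Measurable.aestronglyMeasurable (by fun_prop)) ?_
      refine (ae_restrict_iff' measurableSet_ball).2 (Filter.Eventually.of_forall fun z hz => ?_)
      have hz1 : z ∈ Metric.ball l ρ := Metric.ball_subset_ball (min_le_left _ _) hz
      have hz2 : ‖z - l‖ < 1 := by
        rw [mem_ball_iff_norm] at hz
        exact hz.trans_le ((min_le_right _ _).trans (min_le_right _ _))
      rcases eq_or_ne z l with rfl | hzl
      · simp
        positivity
      have hpos : 0 < ‖z - l‖ := norm_pos_iff.2 (sub_ne_zero.2 hzl)
      rw [Real.norm_of_nonneg (by positivity), inv_mul_eq_div, le_div_iff₀ (by positivity),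
        hKL, norm_mul, norm_pow, mul_pow, ← pow_mul, le_div_iff₀ (by positivity)]
      have h1 : (‖L l‖ / 2) ^ 2 ≤ ‖L z‖ ^ 2 :=
        pow_le_pow_left₀ hc.le (hρL z hz1).le 2
      have h2 : ‖z - l‖ ^ (2 * m) ≤ ‖z - l‖ ^ (n * 2 + 2) :=
        pow_le_pow_of_le_one hpos.le hz2.le (by omega)
      calc (‖z - l‖ ^ 2)⁻¹ * (‖L l‖ / 2) ^ 2 * ‖z - l‖ ^ (2 * m)
          ≤ (‖z - l‖ ^ 2)⁻¹ * ‖L z‖ ^ 2 * ‖z - l‖ ^ (n * 2 + 2) := by gcongr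
        _ = ‖z - l‖ ^ (n * 2) * ‖L z‖ ^ 2 := by rw [pow_add]; field_simp
    refine ⟨dslope L l, ?_, fun z => ?_⟩
    · rw [← differentiableOn_univ]
      exact (Complex.differentiableOn_dslope Filter.univ_mem).2 hL.differentiableOn
    · have := sub_smul_dslope L l z
      rw [hL0, sub_zero, smul_eq_mul] at this
      rw [hKL, ← this, pow_succ]
      ring

/-! ### Gluing local data -/

namespace Fock

open scoped ContDiff

theorem norm_sum_mul_sq_le {S : Finset ℂ} {u f : ℂ → ℂ} {K : ℝ}
    (hu : ∀ l ∈ S, ‖u l‖ ≤ K) (hdis : ∀ l ∈ S, ∀ l' ∈ S, u l ≠ 0 → u l' ≠ 0 → l = l') :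
    ‖∑ l ∈ S, u l * f l‖ ^ 2 ≤ K ^ 2 * ∑ l ∈ S, ‖f l‖ ^ 2 := by
  have hnn : 0 ≤ ∑ l ∈ S, ‖f l‖ ^ 2 := Finset.sum_nonneg fun l _ => by positivity
  by_cases h : ∀ l ∈ S, u l = 0
  · rw [Finset.sum_eq_zero fun l hl => by rw [h l hl, zero_mul]]
    rw [norm_zero, zero_pow two_ne_zero]
    positivity
  push Not at h
  obtain ⟨l, hl, hne⟩ := h
  rw [Finset.sum_eq_single_of_mem l hl fun l' hl' hll => by
    by_contra hc
    exact hll (hdis l' hl' l hl (left_ne_zero_of_mul hc) hne)]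
  rw [norm_mul, mul_pow]
  have h1 := hu l hl
  have h2 : ‖f l‖ ^ 2 ≤ ∑ l ∈ S, ‖f l‖ ^ 2 :=
    Finset.single_le_sum (f := fun l => ‖f l‖ ^ 2) (fun l _ => by positivity) hl
  gcongr

variable {α : ℝ} {S : Finset ℂ} {m : ℂ → ℕ} {a b d : ℂ → ℝ}

theorem integral_mul_dbar_eq_neg {f h : ℂ → ℂ} (hf : ContDiff ℝ 1 f) (hh : ∀ z, dbar f z = h z)
    {χ : ℂ → ℂ} (hχ : ContDiff ℝ ∞ χ) (hc : HasCompactSupport χ) :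
    ∫ z, f z * dbar χ z = -∫ z, h z * χ z := by
  have hχ1 : ContDiff ℝ 1 χ := hχ.of_le (by norm_cast)
  have h1 : ∀ z, dbar (fun w => f w * χ w) z = h z * χ z + f z * dbar χ z := fun z => by
    rw [((HasWirtinger.of_differentiableAt (hf.differentiable one_ne_zero z)).mul
      (HasWirtinger.of_differentiableAt (hχ1.differentiable one_ne_zero z))).dbar_eq, hh]
  have h2 := integral_dbar_eq_zero (hf.mul hχ1) hc.mul_left
  have hhc : Continuous h := by
    have : h = dbar f := by ext z; rw [hh]
    rw [this]; exact dbar_continuous hf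
  simp_rw [h1] at h2
  rw [integral_add] at h2
  · linear_combination h2
  · exact (hhc.mul hχ.continuous).integrable_of_hasCompactSupport hc.mul_left
  · exact (hf.continuous.mul (dbar_continuous hχ1)).integrable_of_hasCompactSupport
      hc.dbar.mul_left

/-- The cutoff gradients live in the annuli b ≤ |z-l|² ≤ d, where |F|²G = exp(α|z|²) and the
Laplacian of log G is α. There dividing ∂̄f0 by F costs nothing in the weighted norm. Multiplying
the solution by F costs nothing anywhere, as |F|²G ≤ exp(α|z|²). -/
theorem exists_glue (hα : 0 < α) (ha : ∀ l ∈ S, 0 < a l) (hab : ∀ l ∈ S, a l < b l)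
    (hbd : ∀ l ∈ S, b l < d l) (hm : ∀ l ∈ S, (m l : ℝ) = α * ((a l + b l) / 2))
    (hdis : ∀ l ∈ S, ∀ l' ∈ S, ∀ z, ‖z - l‖ ^ 2 < d l → ‖z - l'‖ ^ 2 < d l' → l = l')
    {K : ℝ} (hK : ∀ l ∈ S, ∀ z, ‖cutoffDbar (b l) (d l) l z‖ ≤ K)
    {φ : ℂ → ℂ → ℂ} (hφ : ∀ l ∈ S, Mem α (φ l)) :
    ∃ f : ℂ → ℂ, Mem α f ∧
      ∫ z, ‖f z‖ ^ 2 * Real.exp (-α * ‖z‖ ^ 2) ≤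
        (2 + 2 * (α⁻¹ * K ^ 2)) * ∑ l ∈ S, ∫ z, ‖φ l z‖ ^ 2 * Real.exp (-α * ‖z‖ ^ 2) ∧
      ∀ l ∈ S, ∃ L : ℂ → ℂ, Differentiable ℂ L ∧ ∀ z, f z - φ l z = (z - l) ^ m l * L z := by
  set G := weight α S a b with hG
  have hG0 : ∀ z, 0 < G z := fun z => weight_pos z
  have hGc : Continuous G := continuous_weight ha hab
  set F : ℂ → ℂ := fun z => ∏ l ∈ S, (z - l) ^ m l with hF
  have hFd : Differentiable ℂ F := by fun_prop
  have hFs : ContDiff ℝ ∞ F := (hFd.contDiff (n := ∞)).restrict_scalars ℝ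
  have hFc : Continuous F := hFd.continuous
  set f0 : ℂ → ℂ := fun z => ∑ l ∈ S, (cutoff (b l) (d l) l z : ℂ) * φ l z with hf0
  set h : ℂ → ℂ := fun z => ∑ l ∈ S, cutoffDbar (b l) (d l) l z * φ l z with hh
  set P : ℂ → ℝ := fun z => (∑ l ∈ S, ‖φ l z‖ ^ 2) * Real.exp (-α * ‖z‖ ^ 2) with hP
  have hPi : Integrable P := by
    simp only [hP, Finset.sum_mul]
    exact integrable_finsetSum _ fun l hl => (hφ l hl).2
  have hPint : ∫ z, P z = ∑ l ∈ S, ∫ z, ‖φ l z‖ ^ 2 * Real.exp (-α * ‖z‖ ^ 2) := by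
    simp only [hP, Finset.sum_mul]
    exact integral_finsetSum _ fun l hl => (hφ l hl).2
  have hφ1 : ∀ l ∈ S, ContDiff ℝ 1 (φ l) := fun l hl =>
    ((hφ l hl).1.contDiff (n := 1)).restrict_scalars ℝ
  have hf0s : ContDiff ℝ 1 f0 := ContDiff.sum fun l hl => contDiff_cutoff.mul (hφ1 l hl)
  have hdb : ∀ z, dbar f0 z = h z := fun z => by
    refine ((HasWirtinger.sum fun l hl => hasWirtinger_cutoff.mul
      (HasWirtinger.of_hasDerivAt ((hφ l hl).1 z).hasDerivAt)).congr rfl ?_).dbar_eq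
    simp [hh]
  have hhc : Continuous h := by
    have : h = dbar f0 := by ext z; rw [hdb]
    rw [this]; exact dbar_continuous hf0s
  have hf0le : ∀ z, ‖f0 z‖ ^ 2 * Real.exp (-α * ‖z‖ ^ 2) ≤ P z := fun z => by
    have := norm_sum_mul_sq_le (S := S) (u := fun l => (cutoff (b l) (d l) l z : ℂ))
      (f := fun l => φ l z) (fun l _ => norm_cutoff_le_one) (by
        intro l hl l' hl' h1 h2
        refine hdis l hl l' hl' z ?_ ?_
        · by_contra! hc
          exact h1 (by rw [cutoff_of_ge (hbd l hl) hc, Complex.ofReal_zero])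
        · by_contra! hc
          exact h2 (by rw [cutoff_of_ge (hbd l' hl') hc, Complex.ofReal_zero]))
    rw [one_pow, one_mul] at this
    exact mul_le_mul_of_nonneg_right this (Real.exp_nonneg _)
  have hhle : ∀ z, ‖h z‖ ^ 2 * Real.exp (-α * ‖z‖ ^ 2) ≤ K ^ 2 * P z := fun z => by
    have := norm_sum_mul_sq_le (S := S) (u := fun l => cutoffDbar (b l) (d l) l z)
      (f := fun l => φ l z) (fun l hl => hK l hl z) (by
        intro l hl l' hl' h1 h2
        refine hdis l hl l' hl' z ?_ ?_
        · by_contra! hc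
          exact h1 (cutoffDbar_of_ge (hbd l hl) hc)
        · by_contra! hc
          exact h2 (cutoffDbar_of_ge (hbd l' hl') hc))
    have h2 := mul_le_mul_of_nonneg_right this (Real.exp_nonneg (-α * ‖z‖ ^ 2))
    rw [mul_assoc] at h2
    exact h2
  have hhne : ∀ z, h z ≠ 0 → ∀ l ∈ S, b l ≤ ‖z - l‖ ^ 2 := by
    intro z hz l' hl'
    obtain ⟨l, hl, hne⟩ := Finset.exists_ne_zero_of_sum_ne_zero hz
    have h1 : cutoffDbar (b l) (d l) l z ≠ 0 := left_ne_zero_of_mul hne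
    have h2 : b l ≤ ‖z - l‖ ^ 2 := by
      by_contra! hc
      exact h1 (cutoffDbar_of_le (hbd l hl) hc.le)
    have h3 : ‖z - l‖ ^ 2 < d l := by
      by_contra! hc
      exact h1 (cutoffDbar_of_ge (hbd l hl) hc)
    by_contra! hc
    have := hdis l hl l' hl' z h3 (hc.trans (hbd l' hl'))
    subst this
    exact absurd h2 (not_le.2 hc)
  have hexp : ∀ z : ℂ, Real.exp (-α * ‖z‖ ^ 2) = (Real.exp (α * ‖z‖ ^ 2))⁻¹ := fun z => by
    rw [← Real.exp_neg]; congr 1; ring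
  have hFG : ∀ z, h z ≠ 0 → ‖F z‖ ^ 2 * G z = Real.exp (α * ‖z‖ ^ 2) := fun z hz =>
    norm_prod_sq_mul_weight_eq ha hab hm (hhne z hz)
  have hFne : ∀ z, h z ≠ 0 → F z ≠ 0 := by
    intro z hz h0
    have := hFG z hz
    rw [h0] at this
    simp at this
    exact (Real.exp_pos _).ne this
  have hh0 : ∀ z, ‖h z / F z‖ ^ 2 / G z ≤ K ^ 2 * P z := by
    intro z
    refine le_trans ?_ (hhle z)
    by_cases hz : h z = 0
    · simp [hz]
    · rw [norm_div, div_pow, div_div, hFG z hz, hexp, div_eq_mul_inv]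
  have hFm : Measurable F := hFc.measurable
  have hh0m : Measurable fun z => h z / F z := hhc.measurable.div hFm
  have hh0i : Integrable fun z => ‖h z / F z‖ ^ 2 / G z := by
    refine (hPi.const_mul (K ^ 2)).mono'
      ((hh0m.norm.pow_const 2).div hGc.measurable).aestronglyMeasurable
      (Filter.Eventually.of_forall fun z => ?_)
    rw [Real.norm_of_nonneg (div_nonneg (by positivity) (hG0 z).le)]
    exact hh0 z
  obtain ⟨w, hwm, hwi, hwle, hw⟩ := exists_weak_dbar_solution hG0
    (hasWirtinger_weight ha hab) (contDiff_weightDz ha hab) (dbar_weightDz ha hab)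
    (weightLap_nonneg hα hab fun l hl l' hl' z h1 h2 =>
      hdis l hl l' hl' z (h1.trans (hbd l hl)) (h2.trans (hbd l' hl'))) hα
    hh0m.aestronglyMeasurable (fun z hz => by
      rw [weightLap_of_ge hab (hhne z (fun h0 => hz (by rw [h0, zero_div])))]) hh0i
  have hsqc : Continuous fun z => ((Real.sqrt (G z) : ℝ) : ℂ) := by fun_prop
  have hsq0 : ∀ z, ((Real.sqrt (G z) : ℝ) : ℂ) ≠ 0 := fun z => by
    exact_mod_cast (Real.sqrt_pos.2 (hG0 z)).ne'
  have hwL : MemLp (fun z => w z / ((Real.sqrt (G z) : ℝ) : ℂ)) 2 volume := by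
    have hm1 : AEStronglyMeasurable (fun z => w z / ((Real.sqrt (G z) : ℝ) : ℂ)) volume :=
      (hwm.mul (hsqc.inv₀ hsq0).aestronglyMeasurable).congr
        (Filter.Eventually.of_forall fun z => by simp [div_eq_mul_inv])
    refine (memLp_two_iff_integrable_sq_norm hm1).2 (hwi.congr
      (Filter.Eventually.of_forall fun z => ?_))
    simp only [norm_div, div_pow, Complex.norm_real, Real.norm_eq_abs, sq_abs,
      Real.sq_sqrt (hG0 z).le]
  have hwmul : ∀ z, w z = ((Real.sqrt (G z) : ℝ) : ℂ) * (w z / ((Real.sqrt (G z) : ℝ) : ℂ)) :=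
    fun z => by rw [mul_div_cancel₀]; exact hsq0 z
  have hFw : LocallyIntegrable (fun z => F z * w z) volume := by
    have h1 : LocallyIntegrable (fun z => w z / ((Real.sqrt (G z) : ℝ) : ℂ)) volume :=
      hwL.locallyIntegrable (by norm_num)
    have h2 : LocallyIntegrable (fun z => (F z * ((Real.sqrt (G z) : ℝ) : ℂ)) *
        (w z / ((Real.sqrt (G z) : ℝ) : ℂ))) volume := locallyIntegrable_iff.2 fun k hk =>
      (h1.integrableOn_isCompact hk).continuousOn_mul (hFc.mul hsqc).continuousOn hk
    simp_rw [mul_assoc, ← hwmul] at h2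
    exact h2
  have hgl : LocallyIntegrable (fun z => f0 z - F z * w z) volume :=
    hf0s.continuous.locallyIntegrable.sub hFw
  have hweak : ∀ χ : ℂ → ℂ, ContDiff ℝ ∞ χ → HasCompactSupport χ →
      ∫ z, (f0 z - F z * w z) * dbar χ z = 0 := by
    intro χ hχ hc
    have hχ1 : ContDiff ℝ 1 χ := hχ.of_le (by norm_cast)
    -- As F is holomorphic, testing the equation of w against Fχ gives the equation of Fw against χ.
    have hFχ : ContDiff ℝ ∞ fun z => F z * χ z := hFs.mul hχ
    have hFχc : HasCompactSupport fun z => F z * χ z := hc.mul_left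
    have e1 : ∀ z, dbar (fun z => F z * χ z) z = F z * dbar χ z := fun z => by
      rw [((HasWirtinger.of_hasDerivAt (hFd z).hasDerivAt).mul
        (HasWirtinger.of_differentiableAt (hχ1.differentiable one_ne_zero z))).dbar_eq]
      simp
    have e2 : ∀ z, (f0 z - F z * w z) * dbar χ z =
        f0 z * dbar χ z - w z * dbar (fun z => F z * χ z) z := fun z => by
      rw [e1]; ring
    have e3 : ∀ z, h z / F z * (F z * χ z) = h z * χ z := fun z => by
      by_cases hz : h z = 0
      · simp [hz]
      · have := hFne z hz
        field_simp
    have i1 : Integrable fun z => f0 z * dbar χ z :=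
      (hf0s.continuous.mul (dbar_continuous hχ1)).integrable_of_hasCompactSupport hc.dbar.mul_left
    have i2 : Integrable fun z => w z * dbar (fun z => F z * χ z) z := by
      have h1 := integrable_mul_of_memLp_two hwL
        (Continuous.memLp_of_hasCompactSupport (p := 2) (μ := volume)
          (hsqc.mul (dbar_continuous (hFχ.of_le (by norm_cast) : ContDiff ℝ 1 _)))
          hFχc.dbar.mul_left)
      refine h1.congr (Filter.Eventually.of_forall fun z => ?_)
      simp only [Pi.mul_apply]
      rw [← mul_assoc, div_mul_cancel₀ _ (hsq0 z)]
    simp_rw [e2]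
    rw [integral_sub i1 i2, hw _ hFχ hFχc, integral_mul_dbar_eq_neg hf0s hdb hχ hc]
    simp_rw [e3]
    ring
  obtain ⟨f, hfd, hfae⟩ := exists_entire_ae_eq hgl hweak
  have hFw2 : ∀ z, ‖F z * w z‖ ^ 2 * Real.exp (-α * ‖z‖ ^ 2) ≤ ‖w z‖ ^ 2 / G z := by
    intro z
    have h1 := norm_prod_sq_mul_weight_le hα ha hab hm z
    rw [norm_mul, mul_pow, le_div_iff₀ (hG0 z), hexp]
    have h2 := Real.exp_pos (α * ‖z‖ ^ 2)
    calc ‖F z‖ ^ 2 * ‖w z‖ ^ 2 * (Real.exp (α * ‖z‖ ^ 2))⁻¹ * G z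
        = (‖F z‖ ^ 2 * G z) * (Real.exp (α * ‖z‖ ^ 2))⁻¹ * ‖w z‖ ^ 2 := by ring
      _ ≤ Real.exp (α * ‖z‖ ^ 2) * (Real.exp (α * ‖z‖ ^ 2))⁻¹ * ‖w z‖ ^ 2 := by gcongr
      _ = ‖w z‖ ^ 2 := by rw [mul_inv_cancel₀ h2.ne', one_mul]
  have hfle : ∀ᵐ z, ‖f z‖ ^ 2 * Real.exp (-α * ‖z‖ ^ 2) ≤ 2 * P z + 2 * (‖w z‖ ^ 2 / G z) := by
    filter_upwards [hfae] with z hz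
    rw [← hz]
    have h1 : ‖f0 z - F z * w z‖ ^ 2 ≤ 2 * ‖f0 z‖ ^ 2 + 2 * ‖F z * w z‖ ^ 2 := by
      have := pow_le_pow_left₀ (norm_nonneg _) (norm_sub_le (f0 z) (F z * w z)) 2
      nlinarith [sq_nonneg (‖f0 z‖ - ‖F z * w z‖)]
    have h2 := mul_le_mul_of_nonneg_right h1 (Real.exp_nonneg (-α * ‖z‖ ^ 2))
    nlinarith [hf0le z, hFw2 z]
  have hbi : Integrable fun z => 2 * P z + 2 * (‖w z‖ ^ 2 / G z) :=
    (hPi.const_mul 2).add (hwi.const_mul 2)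
  have hfi : Integrable fun z => ‖f z‖ ^ 2 * Real.exp (-α * ‖z‖ ^ 2) := by
    refine hbi.mono' ?_ ?_
    · have := hfd.continuous
      exact Continuous.aestronglyMeasurable (by fun_prop)
    · filter_upwards [hfle] with z hz
      rwa [Real.norm_of_nonneg (by positivity)]
  refine ⟨f, ⟨hfd, hfi⟩, ?_, ?_⟩
  · refine (integral_mono_ae hfi hbi hfle).trans ?_
    rw [integral_add (hPi.const_mul 2) (hwi.const_mul 2), integral_const_mul, integral_const_mul,
      ← hPint]
    have h1 : ∫ z, ‖h z / F z‖ ^ 2 / G z ≤ K ^ 2 * ∫ z, P z := by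
      rw [← integral_const_mul]
      exact integral_mono hh0i (hPi.const_mul _) hh0
    have h2 : ∫ z, ‖w z‖ ^ 2 / G z ≤ α⁻¹ * (K ^ 2 * ∫ z, P z) := hwle.trans (by gcongr)
    linarith
  · intro l hl
    have hbl : 0 < b l := (ha l hl).trans (hab l hl)
    refine exists_eq_pow_mul_of_integrableOn (hfd.sub (hφ l hl).1) (Real.sqrt_pos.2 hbl) (m l) ?_
    set F' : ℂ → ℂ := fun z => ∏ l' ∈ S.erase l, (z - l') ^ m l' with hF'
    have hF'c : Continuous F' := by fun_prop
    have hFF' : ∀ z, F z = (z - l) ^ m l * F' z := fun z =>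
      (Finset.mul_prod_erase S (fun l' => (z - l') ^ m l') hl).symm
    -- Near l only the cutoff of l is present and equals 1, so f - φ_l = -F w. After division by
    -- (z-l)^(m l) the factor F' remains, and |F'|²G is bounded on the disc.
    obtain ⟨B, hB⟩ := (isCompact_closedBall l (Real.sqrt (b l))).exists_bound_of_continuousOn
      (f := fun z => ‖F' z‖ ^ 2 * G z) (by fun_prop)
    refine Integrable.mono' ((hwi.const_mul B).integrableOn) ?_ ?_
    · have h1 := hfd.continuous.measurable
      have h2 := (hφ l hl).1.continuous.measurable
      exact Measurable.aestronglyMeasurable (by fun_prop)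
    · refine (ae_restrict_iff' measurableSet_ball).2 ?_
      filter_upwards [hfae] with z hz hzb
      have hB' := hB z (Metric.ball_subset_closedBall hzb)
      rw [Real.norm_of_nonneg (mul_nonneg (by positivity) (hG0 z).le)] at hB'
      rw [mem_ball_iff_norm] at hzb
      have hzb2 : ‖z - l‖ ^ 2 < b l := by
        have := pow_lt_pow_left₀ hzb (norm_nonneg _) two_ne_zero
        rwa [Real.sq_sqrt hbl.le] at this
      have hf0z : f0 z = φ l z := by
        simp only [hf0]
        rw [Finset.sum_eq_single_of_mem l hl, cutoff_of_le (hbd l hl) hzb2.le, Complex.ofReal_one,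
          one_mul]
        intro l' hl' hne
        rw [cutoff_of_ge (hbd l' hl'), Complex.ofReal_zero, zero_mul]
        by_contra! hc
        exact hne (hdis l' hl' l hl z hc (hzb2.trans (hbd l hl)))
      have hBpos : 0 ≤ B := le_trans (mul_nonneg (by positivity) (hG0 z).le) hB'
      have hwz : 0 ≤ ‖w z‖ ^ 2 / G z := div_nonneg (by positivity) (hG0 z).le
      rw [Real.norm_of_nonneg (by positivity)]
      simp only [Pi.sub_apply]
      rw [← hz, hf0z, sub_sub_cancel_left, norm_neg, hFF', norm_mul, norm_mul, norm_pow]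
      rcases eq_or_ne z l with rfl | hzl
      -- At the center the quotient is 0 by the division convention, unless m = 0, when its
      -- denominator is 1.
      · by_cases hm0 : m z = 0
        · simp only [hm0, sub_self, norm_zero, pow_zero, one_mul, mul_zero, div_one]
          calc (‖F' z‖ * ‖w z‖) ^ 2 = ‖F' z‖ ^ 2 * G z * (‖w z‖ ^ 2 / G z) := by
                have := (hG0 z).ne'
                field_simp
            _ ≤ B * (‖w z‖ ^ 2 / G z) := by gcongr
        · simp [hm0]
          positivity
      · have hpos : 0 < ‖z - l‖ := norm_pos_iff.2 (sub_ne_zero.2 hzl)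
        calc (‖z - l‖ ^ m l * ‖F' z‖ * ‖w z‖) ^ 2 / ‖z - l‖ ^ (2 * m l)
            = ‖F' z‖ ^ 2 * G z * (‖w z‖ ^ 2 / G z) := by
              have := (hG0 z).ne'
              rw [mul_comm 2 (m l), pow_mul]
              field_simp
          _ ≤ B * (‖w z‖ ^ 2 / G z) := by gcongr

end Fock

/-! ### Sufficiency -/

namespace Fock

open ComplexConjugate
open scoped ContDiff

variable {α : ℝ}

/-- Translating l to the origin preserves the order of the zero and reduces to `ip_pow_mul_e`. -/
theorem ip_T_e_eq_zero (hα : 0 < α) {K L : ℂ → ℂ} (hK : Mem α K) (hL : Differentiable ℂ L) {l : ℂ}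
    {m k : ℕ} (hk : k < m) (h : ∀ z, K z = (z - l) ^ m * L z) : ip α K (T α l (e α k)) = 0 := by
  have h1 : T α (-l) K = fun z => z ^ m * (Complex.exp ((α : ℂ) * conj (-l) * z -
      ((α / 2 * ‖-l‖ ^ 2 : ℝ) : ℂ)) * L (z + l)) := by
    ext z
    rw [T, h, sub_neg_eq_add, add_sub_cancel_right]
    ring
  have h2 := hK.T (-l)
  rw [ip_T_right]
  rw [h1] at h2 ⊢
  refine ip_pow_mul_e hα ?_ hk h2
  have : Differentiable ℂ fun z => L (z + l) := hL.comp (by fun_prop)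
  exact Differentiable.mul (by fun_prop) this

/-- Interpolation on finitely many points, with a uniform bound. -/
theorem exists_interpolant_finset (hα : 0 < α) {C : ℝ} (hC : 0 < C) :
    ∃ M : ℝ, 0 ≤ M ∧ ∀ (Λ : Set ℂ) (m : Λ → ℕ) (S : Finset Λ), (∀ l ∈ S, 1 ≤ m l) →
      (Pairwise fun l l' : Λ => Disjoint (Metric.ball (l : ℂ) (Real.sqrt ((m l : ℝ) / α) + C))
        (Metric.ball (l' : ℂ) (Real.sqrt ((m l' : ℝ) / α) + C))) →
      ∀ v : (l : Λ) → Fin (m l) → ℂ, ∃ f : submodule hα,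
        ‖toL2 hα f‖ ^ 2 ≤ M * ∑ l ∈ S, ∑ k, ‖v l k‖ ^ 2 ∧
        ∀ l ∈ S, ∀ k : Fin (m l), ip α f (T α (l : ℂ) (e α (k : ℕ))) = v l k := by
  obtain ⟨K, hK0, hK⟩ := exists_abs_deriv_smoothTransition_le
  -- With R = √(m/α), d = (R + C)² and b = R² + κ, the choice κ ≤ C²/4 gives d - b ≥ (3C/4)(R + C).
  -- Hence √d/(d - b) ≤ 4/(3C) for all multiplicities. The choice κ ≤ 1/(2α) keeps a = m/α - κ
  -- positive when m ≥ 1.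
  set K1 := K * (4 / (3 * C)) with hK1
  set κ := min (C ^ 2 / 4) (1 / (2 * α)) with hκ
  have hκ0 : 0 < κ := by positivity
  refine ⟨2 + 2 * (α⁻¹ * K1 ^ 2), by positivity, fun Λ m S hm1 hdis v => ?_⟩
  let m' : ℂ → ℕ := Function.extend Subtype.val m 0
  have hm' : ∀ l : Λ, m' l = m l := fun l => Subtype.val_injective.extend_apply _ _ _
  let φ0 : Λ → submodule hα := fun l => ∑ k : Fin (m l), v l k • ⟨_, mem_T_e hα l k⟩
  have hφ0 : ∀ l, toL2 hα (φ0 l) = ∑ k : Fin (m l), v l k • kernelL2 hα l k := fun l => by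
    simp [φ0, kernelL2]
  let φ : ℂ → ℂ → ℂ := Function.extend Subtype.val (fun l => (φ0 l : ℂ → ℂ)) 0
  have hφ : ∀ l : Λ, φ l = φ0 l := fun l => Subtype.val_injective.extend_apply _ _ _
  let a : ℂ → ℝ := fun l => (m' l : ℝ) / α - κ
  let b : ℂ → ℝ := fun l => (m' l : ℝ) / α + κ
  let d : ℂ → ℝ := fun l => (Real.sqrt ((m' l : ℝ) / α) + C) ^ 2
  have hdb : ∀ l, 3 * C / 4 * (Real.sqrt ((m' l : ℝ) / α) + C) ≤ d l - b l := by
    intro l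
    have h1 : κ ≤ C ^ 2 / 4 := min_le_left _ _
    have h2 : Real.sqrt ((m' l : ℝ) / α) ^ 2 = (m' l : ℝ) / α := Real.sq_sqrt (by positivity)
    have h3 := Real.sqrt_nonneg ((m' l : ℝ) / α)
    simp only [d, b]
    nlinarith
  have hbd : ∀ l, b l < d l := fun l => by
    have : 0 < 3 * C / 4 * (Real.sqrt ((m' l : ℝ) / α) + C) := by positivity
    linarith [hdb l]
  have hortho := fun l : Λ => (orthonormal_kernelL2 hα (l : ℂ)).comp
    (fun k : Fin (m l) => (k : ℕ)) Fin.val_injective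
  obtain ⟨f, hf, hfn, hfL⟩ := exists_glue (S := S.map (Function.Embedding.subtype _)) (m := m')
    (a := a) (b := b) (d := d) (K := K1) (φ := φ) hα
    (by
      simp only [Finset.forall_mem_map, Function.Embedding.subtype_apply]
      intro l hl
      have h1 : κ ≤ 1 / (2 * α) := min_le_right _ _
      have h2 : (1 : ℝ) ≤ m l := by exact_mod_cast hm1 l hl
      have h3 : 1 / (2 * α) < (m l : ℝ) / α := by
        rw [div_lt_div_iff₀ (by positivity) hα]
        nlinarith
      simp only [a, hm']
      linarith)
    (fun l _ => by simp only [a, b]; linarith)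
    (fun l _ => hbd l)
    (fun l _ => by simp only [a, b]; field_simp; ring)
    (by
      simp only [Finset.forall_mem_map, Function.Embedding.subtype_apply]
      intro l _ l' _ z h1 h2
      by_contra hne
      have hd : Disjoint (Metric.ball (l : ℂ) (Real.sqrt ((m l : ℝ) / α) + C))
        (Metric.ball (l' : ℂ) (Real.sqrt ((m l' : ℝ) / α) + C)) :=
        hdis fun h => hne (by rw [h])
      refine Set.disjoint_left.1 hd (?_ : z ∈ _) ?_
      · rw [mem_ball_iff_norm, ← hm']
        exact lt_of_pow_lt_pow_left₀ 2 (by positivity) h1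
      · rw [mem_ball_iff_norm, ← hm']
        exact lt_of_pow_lt_pow_left₀ 2 (by positivity) h2)
    (fun l _ z => by
      refine (norm_cutoffDbar_le (hbd l) hK).trans ?_
      rw [hK1]
      refine mul_le_mul_of_nonneg_left ?_ hK0
      have h1 : 0 < Real.sqrt ((m' l : ℝ) / α) + C := by positivity
      rw [div_le_div_iff₀ (sub_pos.2 (hbd l)) (by positivity)]
      simp only [d] at hdb ⊢
      rw [Real.sqrt_sq h1.le]
      linarith [hdb l])
    (by
      simp only [Finset.forall_mem_map, Function.Embedding.subtype_apply]
      intro l _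
      rw [hφ]
      exact (φ0 l).2)
  simp only [Finset.forall_mem_map, Function.Embedding.subtype_apply, hφ, hm'] at hfL
  simp only [Finset.sum_map, Function.Embedding.subtype_apply, hφ] at hfn
  refine ⟨⟨f, hf⟩, ?_, fun l hl k => ?_⟩
  · have hpi := Real.pi_pos
    have h1 : ∀ l, ∑ k, ‖v l k‖ ^ 2 =
        α / Real.pi * ∫ z, ‖(φ0 l).1 z‖ ^ 2 * Real.exp (-α * ‖z‖ ^ 2) := by
      intro l
      rw [← norm_toL2_sq hα, hφ0]
      have h3 := (hortho l).inner_sum (v l) (v l) Finset.univ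
      rw [inner_self_eq_norm_sq_to_K] at h3
      simp_rw [Complex.conj_mul'] at h3
      apply Complex.ofReal_injective
      push_cast
      exact h3.symm
    rw [norm_toL2_sq]
    simp_rw [h1, ← Finset.mul_sum]
    calc α / Real.pi * ∫ z, ‖f z‖ ^ 2 * Real.exp (-α * ‖z‖ ^ 2)
        ≤ α / Real.pi * ((2 + 2 * (α⁻¹ * K1 ^ 2)) *
          ∑ l ∈ S, ∫ z, ‖(φ0 l).1 z‖ ^ 2 * Real.exp (-α * ‖z‖ ^ 2)) := by gcongr
      _ = _ := by ring
  · obtain ⟨L, hL, hfφ⟩ := hfL l hl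
    have h1 : ip α ((⟨f, hf⟩ : submodule hα) - φ0 l : submodule hα).1 (T α l (e α k)) = 0 :=
      ip_T_e_eq_zero hα ((⟨f, hf⟩ : submodule hα) - φ0 l).2 hL k.2 hfφ
    have h2 := inner_toL2 hα (⟨f, hf⟩ - φ0 l) ⟨_, mem_T_e hα l k⟩
    rw [h1, map_sub, inner_sub_right, sub_eq_zero, inner_toL2, hφ0] at h2
    refine h2.trans ?_
    exact (hortho l).inner_right_fintype (v l) k

theorem isInterpolating_of_disjoint (hα : 0 < α) {Λ : Set ℂ} {m : Λ → ℕ} {C : ℝ} (hC : 0 < C)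
    (hdis : Pairwise fun l l' : Λ => Disjoint (Metric.ball (l : ℂ) (Real.sqrt ((m l : ℝ) / α) + C))
        (Metric.ball (l' : ℂ) (Real.sqrt ((m l' : ℝ) / α) + C))) :
    IsInterpolating α Λ m := by
  classical
  intro v hv
  obtain ⟨M, hM, hfin⟩ := exists_interpolant_finset hα hC
  have hρ : Continuous fun z : ℂ => ((Real.exp (α / 2 * ‖z‖ ^ 2) : ℝ) : ℂ) := by fun_prop
  -- The duality takes place in all of L². Orthogonality to the vectors of the second kind says that
  -- exp(α|z|²/2) y is weakly holomorphic, which places y in the image of the Fock space.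
  let A : (Σ l : Λ, Fin (m l)) ⊕ testSubmodule → Lp ℂ 2 (volume : Measure ℂ) :=
    Sum.elim (fun i => kernelL2 hα (i.1 : ℂ) i.2)
      (fun χ => (memLp_two_conj (memLp_dbar_mul hρ χ)).toLp _)
  let B : (Σ l : Λ, Fin (m l)) ⊕ testSubmodule → ℂ := Sum.elim (fun i => v i.1 i.2) 0
  set c : ℝ := Real.sqrt (α / Real.pi) with hc
  have hc0 : (c : ℂ) ≠ 0 := by
    have := Real.pi_pos
    have : 0 < c := Real.sqrt_pos.2 (by positivity)
    exact_mod_cast this.ne'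
  have hexp : ∀ z : ℂ, ((Real.exp (-α / 2 * ‖z‖ ^ 2) : ℝ) : ℂ) *
      ((Real.exp (α / 2 * ‖z‖ ^ 2) : ℝ) : ℂ) = 1 := fun z => by
    rw [← Complex.ofReal_mul, ← Real.exp_add, ← Complex.ofReal_one, ← Real.exp_zero]
    congr 2
    ring
  obtain ⟨y, -, hy⟩ := exists_inner_eq_of_forall_finset A B
    (M := Real.sqrt (M * ∑' l, ∑ k, ‖v l k‖ ^ 2)) (Real.sqrt_nonneg _) (by
      intro s
      -- Only points that carry an index occur, so their multiplicities are at least 1.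
      let S : Finset Λ := s.toLeft.image Sigma.fst
      obtain ⟨f, hfn, hf⟩ := hfin Λ m S (by
        simp only [S, Finset.forall_mem_image]
        exact fun i _ => Nat.one_le_of_lt i.2.2) hdis v
      refine ⟨toL2 hα f, Real.le_sqrt_of_sq_le (hfn.trans ?_), ?_⟩
      · gcongr
        exact hv.sum_le_tsum _ fun l _ => Finset.sum_nonneg fun k _ => by positivity
      · rintro (i | χ) hj
        · simp only [A, B, Sum.elim_inl]
          rw [kernelL2, inner_toL2]
          exact hf i.1 (Finset.mem_image_of_mem _ (Finset.mem_toLeft.2 hj)) i.2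
        · simp only [A, B, Sum.elim_inr, Pi.zero_apply]
          obtain ⟨f, hfm⟩ := f
          rw [toL2_apply hα hfm, inner_toLp_toLp]
          have h1 : ∀ z, conj (conj (dbar χ.1 z * ((Real.exp (α / 2 * ‖z‖ ^ 2) : ℝ) : ℂ))) *
              gaussMul α f z = c * (f z * dbar χ.1 z) := fun z => by
            rw [Complex.conj_conj, gaussMul, Complex.ofReal_mul]
            linear_combination (c * f z * dbar χ.1 z) * hexp z
          simp_rw [h1]
          have hf1 : ContDiff ℝ 1 f := (hfm.1.contDiff (n := 1)).restrict_scalars ℝ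
          rw [integral_const_mul, integral_mul_dbar_eq_neg (h := 0) hf1
            (fun z => (HasWirtinger.of_hasDerivAt (hfm.1 z).hasDerivAt).dbar_eq) χ.2.1 χ.2.2]
          simp)
  have hyL : MemLp (y : ℂ → ℂ) 2 volume := Lp.memLp y
  obtain ⟨F, hF, hFae⟩ := exists_entire_ae_eq
    (g := fun z => ((Real.exp (α / 2 * ‖z‖ ^ 2) : ℝ) : ℂ) * y z)
    (locallyIntegrable_iff.2 fun k hk =>
      ((hyL.locallyIntegrable (by norm_num)).integrableOn_isCompact hk).continuousOn_mul
        hρ.continuousOn hk)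
    (by
      intro χ hχ hχc
      have h1 := hy (Sum.inr ⟨χ, hχ, hχc⟩)
      simp only [A, B, Sum.elim_inr, Pi.zero_apply] at h1
      have h2 := inner_toLp_toLp (memLp_two_conj (memLp_dbar_mul hρ ⟨χ, hχ, hχc⟩)) hyL
      rw [Lp.toLp_coeFn, h1] at h2
      rw [h2]
      refine integral_congr_ae (Filter.Eventually.of_forall fun z => ?_)
      simp only [Complex.conj_conj]
      ring)
  set f : ℂ → ℂ := fun z => (c : ℂ)⁻¹ * F z with hf
  have hfae : gaussMul α f =ᵐ[volume] y := by
    filter_upwards [hFae] with z hz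
    rw [gaussMul, hf, Complex.ofReal_mul]
    simp only
    rw [← hz, ← hc]
    linear_combination (((Real.exp (α / 2 * ‖z‖ ^ 2) : ℝ) : ℂ) * y z *
      ((Real.exp (-α / 2 * ‖z‖ ^ 2) : ℝ) : ℂ)) * inv_mul_cancel₀ hc0 + (y z) * hexp z
  have hfm : Mem α f := mem_of_memLp hα (by fun_prop) ((memLp_congr_ae hfae).2 hyL)
  have hfy : toL2 hα ⟨f, hfm⟩ = y := by
    rw [toL2_apply hα hfm]
    refine (MemLp.toLp_congr _ hyL hfae).trans (Lp.toLp_coeFn y hyL)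
  refine ⟨f, hfm, fun l k => ?_⟩
  have h1 := hy (Sum.inl ⟨l, k⟩)
  simp only [A, B, Sum.elim_inl] at h1
  rw [← hfy, kernelL2, inner_toL2] at h1
  exact h1

end Fock

theorem theorem2 (α : ℝ) (hα : 0 < α) (Λ : Set ℂ) (m : Λ → ℕ) :
    (Fock.IsInterpolating α Λ m →
      ∃ C : ℝ, 0 < C ∧
        Set.Pairwise {l : Λ | α * C ^ 2 < (m l : ℝ)} (fun l l' : Λ =>
          Disjoint (Metric.ball (l : ℂ) (Real.sqrt ((m l : ℝ) / α) - C))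
            (Metric.ball (l' : ℂ) (Real.sqrt ((m l' : ℝ) / α) - C)))) ∧
    ((∃ C : ℝ, 0 < C ∧
        Pairwise (fun l l' : Λ =>
          Disjoint (Metric.ball (l : ℂ) (Real.sqrt ((m l : ℝ) / α) + C))
            (Metric.ball (l' : ℂ) (Real.sqrt ((m l' : ℝ) / α) + C)))) →
      Fock.IsInterpolating α Λ m) := by
  refine ⟨fun h => ?_, fun ⟨C, hC, h⟩ => Fock.isInterpolating_of_disjoint hα hC h⟩
  obtain ⟨C, hC, hdis⟩ := h.exists_disjoint hα
  -- Disjointness was shown for all pairs. Discs with m ≤ αC² have nonpositive radius and are empty.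
  exact ⟨C, hC, hdis.set_pairwise _⟩
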